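/- Let $N,T$ be natural numbers, let $\mu_1,\dots,\mu_N\in\mathbb{C}$ satisfy $|\mu_n|=1$ and $\mu_n\neq 1$, and let $L_1,\dots,L_T\in\mathbb{R}[X_1,\dots,X_N]$ be nonzero linear forms with nonnegative coefficients such that for each $n$ there is a $t$ for which $L_t$ really depends on $X_n$. For polynomials $P_1,\dots,P_T$ in variables indexed by a finite set $I$, complex numbers $\nu=(\nu_i)_{i\in I}$ and $\mathbf{s}\in\mathbb{C}^T$, let $Z(1;P_1,\dots,P_T;\nu;\mathbf{s})$ denote the series $\sum_{\mathbf{m}\in\{1,2,\dots\}^I}\bigl(\prod_{i\in I}\nu_i^{m_i}\bigr)\prod_{t=1}^T P_t(\mathbf{m})^{-s_t}$, taken where $\Re(s_1),\dots,\Re(s_T)$ are sufficiently large, and also its holomorphic extension to $\mathbb{C}^T$ when there is one. Let $\mathbf{a}\in\mathbb{N}^N$ (with $0\in\mathbb{N}$), let $E(\mathbf{a})$ be the set of all $\mathbf{m}\in\{1,2,\dots\}^N$ with $m_n\le a_n$ for at least one $n$, and put $\boldsymbol\mu^{\mathbf{m}}=\prod_n\mu_n^{m_n}$. Then: 1. The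 series $Z(\boldsymbol\mu;\mathbf{s})=Z(1;L_1,\dots,L_T;\boldsymbol\mu;\mathbf{s})$ and the series $Z^{\mathbf{a}}_{N-1}(\mathbf{s})=\sum_{\mathbf{m}\in E(\mathbf{a})}\boldsymbol\mu^{\mathbf{m}}\prod_{t=1}^T L_t(\mathbf{m})^{-s_t}$ converge absolutely when $\Re(s_1),\dots,\Re(s_T)$ are sufficiently large, and each of them extends holomorphically to $\mathbb{C}^T$. 2. For $I\subsetneq\{1,\dots,N\}$ and $\mathbf{b}\in\prod_{i\notin I}\{1,\dots,a_i\}$ let $L_t^{\mathbf{a},I,\mathbf{b}}$ be the polynomial in the variables $(X_i)_{i\in I}$ obtained from $L_t$ by replacing $X_i$ by $a_i+X_i$ for $i\in I$ and by $b_i$ for $i\notin I$. These are nonzero polynomials of degree at most $1$ with nonnegative coefficients, in at most $N-1$ variables, each variable really occurring in at least one of them; the series $Z(1;L_1^{\mathbf{a},I,\mathbf{b}},\dots,L_T^{\mathbf{a},I,\mathbf{b}};(\mu_i)_{i\in I};\mathbf{s})$ converges absolutely when all $\Re(s_t)$ are sufficiently large and extends holomorphically to $\mathbb{C}^T$; and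 for all $\mathbf{s}\in\mathbb{C}^T$ $$Z^{\mathbf{a}}_{N-1}(\mathbf{s})=\sum_{I\subsetneq\{1,\dots,N\}}\ \sum_{\mathbf{b}\in\prod_{i\notin I}\{1,\dots,a_i\}}\Bigl(\prod_{i\notin I}\mu_i^{b_i}\Bigr)\Bigl(\prod_{i\in I}\mu_i^{a_i}\Bigr)\,Z\bigl(1;L_1^{\mathbf{a},I,\mathbf{b}},\dots,L_T^{\mathbf{a},I,\mathbf{b}};(\mu_i)_{i\in I};\mathbf{s}\bigr).$$ 3. For each $t$ the polynomial $\delta_t=L_t(\mathbf{X}+\mathbf{a})-L_t(\mathbf{X})$ is a real constant, and for all $\mathbf{k}\in\mathbb{N}^T$ $$(1-\boldsymbol\mu^{\mathbf{a}})\,Z(\boldsymbol\mu;-\mathbf{k})=\boldsymbol\mu^{\mathbf{a}}\sum_{\mathbf{0}\le\mathbf{u}\le\mathbf{k},\ \mathbf{u}\neq\mathbf{k}}\Bigl(\prod_{t=1}^T\delta_t^{k_t-u_t}\Bigr)\Bigl(\prod_{t=1}^T\binom{k_t}{u_t}\Bigr)Z(\boldsymbol\mu;-\mathbf{u})+Z^{\mathbf{a}}_{N-1}(-\mathbf{k}),$$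 where $0^0=1$ and the inequalities between tuples are componentwise. -/

import Mathlib

open MvPolynomial

noncomputable section

/-- The set of all points `m` with positive integer coordinates. -/
def posPoints (σ : Type*) : Set (σ → ℕ) := {m | ∀ n, 1 ≤ m n}

/-- The set `E(a)` of the points `m` with positive integer coordinates such that `m n ≤ a n` for
at least one `n`. -/
def lowPoints {σ : Type*} (a : σ → ℕ) : Set (σ → ℕ) := {m | (∀ n, 1 ≤ m n) ∧ ∃ n, m n ≤ a n}

/-- The general term `μ^m Q(m) / ∏ t, P_t(m)^(s_t)` of a twisted multivariable zeta series. -/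
def twistedTerm {σ τ : Type*} [Fintype σ] [Fintype τ] (Q : MvPolynomial σ ℝ)
    (P : τ → MvPolynomial σ ℝ) (μ : σ → ℂ) (s : τ → ℂ) (m : σ → ℕ) : ℂ :=
  (∏ n, μ n ^ m n) * ((eval (fun n => (m n : ℝ)) Q : ℝ) : ℂ) /
    ∏ t, ((eval (fun n => (m n : ℝ)) (P t) : ℝ) : ℂ) ^ s t

/-- `F` is a holomorphic extension to all of `ℂ^τ` of the twisted zeta series
`∑ m ∈ E, μ^m Q(m) / ∏ t, P_t(m)^(s_t)`: it is entire, and when the real parts of all the `s_t`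
are sufficiently large, the series converges (absolutely) to `F s`. -/
structure IsZetaExtension {σ τ : Type*} [Fintype σ] [Fintype τ] (E : Set (σ → ℕ))
    (Q : MvPolynomial σ ℝ) (P : τ → MvPolynomial σ ℝ) (μ : σ → ℂ) (F : (τ → ℂ) → ℂ) :
    Prop where
  differentiable : Differentiable ℂ F
  hasSum : ∃ σ₀ : ℝ, ∀ s : τ → ℂ, (∀ t, σ₀ < (s t).re) →
    HasSum (fun m : E => twistedTerm Q P μ s m) (F s)

/-- A holomorphic extension to `ℂ^τ` is unique. -/
theorem IsZetaExtension.unique {σ τ : Type*} [Fintype σ] [Fintype τ] {E : Set (σ → ℕ)}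
    {Q : MvPolynomial σ ℝ} {P : τ → MvPolynomial σ ℝ} {μ : σ → ℂ} {F G : (τ → ℂ) → ℂ}
    (hF : IsZetaExtension E Q P μ F) (hG : IsZetaExtension E Q P μ G) : F = G := by
  obtain ⟨x, hx⟩ := hF.hasSum
  obtain ⟨y, hy⟩ := hG.hasSum
  have key : ∀ s : τ → ℂ, (∀ t, max x y < (s t).re) → F s = G s := fun s hs =>
    (hx s fun t => (le_max_left _ _).trans_lt (hs t)).unique
      (hy s fun t => (le_max_right _ _).trans_lt (hs t))
  funext s
  set p : τ → ℂ := fun _ => ((max x y + 1 : ℝ) : ℂ) with hp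
  have hl : Differentiable ℂ (fun z : ℂ => p + z • (s - p)) := by fun_prop
  have hf : AnalyticOnNhd ℂ (fun z : ℂ => F (p + z • (s - p))) Set.univ :=
    (hF.differentiable.comp hl).differentiableOn.analyticOnNhd isOpen_univ
  have hg : AnalyticOnNhd ℂ (fun z : ℂ => G (p + z • (s - p))) Set.univ :=
    (hG.differentiable.comp hl).differentiableOn.analyticOnNhd isOpen_univ
  have hev : (fun z : ℂ => F (p + z • (s - p))) =ᶠ[nhds 0]
      (fun z : ℂ => G (p + z • (s - p))) := by
    have hev' : ∀ᶠ z : ℂ in nhds 0, ∀ t, max x y < ((p + z • (s - p)) t).re := by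
      refine Filter.eventually_all.2 fun t => ?_
      have hc : Continuous (fun z : ℂ => ((p + z • (s - p)) t).re) :=
        Complex.continuous_re.comp ((continuous_apply t).comp hl.continuous)
      refine hc.continuousAt.eventually (lt_mem_nhds ?_)
      simp [hp]
    filter_upwards [hev'] with z hz using key _ hz
  have h1 := congrFun (hf.eq_of_eventuallyEq hg hev) 1
  simpa using h1

open Classical in
/-- The twisted zeta function: the holomorphic extension to `ℂ^τ` of the series
`∑ m ∈ E, μ^m Q(m) / ∏ t, P_t(m)^(s_t)` (and `0` if there is none). -/
def twistedZetaOn {σ τ : Type*} [Fintype σ] [Fintype τ] (E : Set (σ → ℕ))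
    (Q : MvPolynomial σ ℝ) (P : τ → MvPolynomial σ ℝ) (μ : σ → ℂ) : (τ → ℂ) → ℂ :=
  if h : ∃ F, IsZetaExtension E Q P μ F then h.choose else 0

/-- `Z(Q; P_1, …, P_T; μ; ·)`, the case of the sum over all points with positive integer
coordinates. -/
def twistedZeta {σ τ : Type*} [Fintype σ] [Fintype τ]
    (Q : MvPolynomial σ ℝ) (P : τ → MvPolynomial σ ℝ) (μ : σ → ℂ) : (τ → ℂ) → ℂ :=
  twistedZetaOn (posPoints σ) Q P μ

/-- `Δ_a P = P(X + a) - P(X)`. -/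
def shiftDiff {σ : Type*} (a : σ → ℕ) (P : MvPolynomial σ ℝ) : MvPolynomial σ ℝ :=
  bind₁ (fun i => X i + C (a i : ℝ)) P - P

/-- The polynomial `P^{a,I,b}` in the variables indexed by `I`: the variable `X_i` becomes
`a_i + X_i` for `i ∈ I`, and is given the value `b_i` for `i ∉ I`. -/
def partialEval {σ : Type*} [DecidableEq σ] (a : σ → ℕ) (I : Finset σ) (b : {i // i ∉ I} → ℕ)
    (P : MvPolynomial σ ℝ) : MvPolynomial I ℝ :=
  bind₁ (fun i => if h : i ∈ I then C (a i : ℝ) + X ⟨i, h⟩ else C (b ⟨i, h⟩ : ℝ)) P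

/-- The points `b`, indexed by the complement of `I`, with `1 ≤ b i ≤ a i` for all `i ∉ I`. -/
def lowBox {σ : Type*} [Fintype σ] [DecidableEq σ] (a : σ → ℕ) (I : Finset σ) :
    Finset ({i // i ∉ I} → ℕ) :=
  Fintype.piFinset fun i => Finset.Icc 1 (a i)

end

/-!
The zeta series of linear forms is summed by one integral that makes sense for every `s`.

Let `‖μ‖ = 1` and `μ ≠ 1`. For `x > 0` the geometric series `∑_{m ≥ 1} (μ e^{-x})^m`, multiplied by
`e^{x/2}`, has the sum `1 / (μ⁻¹ e^{x/2} - e^{-x/2})`, and this expression is a Schwartz function of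
`x` on the whole real line (`exists_schwartzMap_eq_expKernel`). Fourier inversion therefore writes
the geometric series as `∫ K(y) e^{-x z(y)} dy`, where `z(y)` runs along the line `Re z = 1/2` and
`K` is rapidly decreasing (`exists_schwartzMap_hasSum`). The Mellin formula
`Γ(s) ℓ^{-s} = ∫ x^{s-1} e^{-xℓ} dx`, valid for `Re ℓ > 0`, turns products of powers of affine forms
into superpositions of exponentials, so that for large `Re s_t`
`∑_m μ^m ∏_t ℓ_t(m)^{-s_t} = ∫ ∏_n K_n(y_n) ∏_t ℓ_t(z(y))^{-s_t} dy` (`hasSum_zetaIntegral`).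
On the right `Re ℓ_t` is bounded below by a positive constant and `log ℓ_t` grows logarithmically,
while the `K_n` decrease rapidly: the integral is an entire function of `s`
(`differentiable_zetaIntegral`).

The points with positive integer coordinates are those of `lowPoints a` together with the translates
by `a` of all such points, and `lowPoints a` splits according to the set `I` of the indices with
`a i < m i` and the values of the other coordinates. Both decompositions give identities between
series for large `Re s_t`, hence between entire functions (`zetaIntegral_eq_add`,
`isZetaExtension_lowPoints`). At `s = -k` the integrand is a polynomial in the values of the linear
forms, and the binomial theorem under the integral sign expands the translated zeta function
(`zetaIntegral_neg_eq_sum`), which yields the recurrence relation.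
-/

noncomputable section

open MeasureTheory Set
open scoped SchwartzMap

/-! ### A rapidly decreasing kernel for one variable -/

section

open scoped FourierTransform ContDiff Nat

lemma sq_norm_mul_exp_sub_exp {ν : ℂ} (hν : ‖ν‖ = 1) (x : ℝ) :
    ‖ν * (Real.exp (x / 2) : ℂ) - (Real.exp (-(x / 2)) : ℂ)‖ ^ 2 =
      Real.exp x + Real.exp (-x) - 2 * ν.re := by
  have h1 : ν.re ^ 2 + ν.im ^ 2 = 1 := by
    have := Complex.sq_norm ν
    rw [hν, Complex.normSq_apply] at this
    linarith
  have e1 : Real.exp x = Real.exp (x / 2) ^ 2 := by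
    rw [← Real.exp_nat_mul]; congr 1; push_cast; ring
  have e2 : Real.exp (-x) = Real.exp (-(x / 2)) ^ 2 := by
    rw [← Real.exp_nat_mul]; congr 1; push_cast; ring
  have e3 : Real.exp (x / 2) * Real.exp (-(x / 2)) = 1 := by rw [← Real.exp_add]; simp
  rw [Complex.sq_norm, Complex.normSq_apply, e1, e2]
  simp only [Complex.sub_re, Complex.mul_re, Complex.ofReal_re, Complex.ofReal_im, Complex.sub_im,
    Complex.mul_im]
  linear_combination Real.exp (x / 2) ^ 2 * h1 - 2 * ν.re * e3

lemma re_lt_one_of_norm_eq_one {ν : ℂ} (hν : ‖ν‖ = 1) (hν1 : ν ≠ 1) : ν.re < 1 := by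
  refine lt_of_le_of_ne (hν ▸ Complex.re_le_norm ν) fun h => hν1 ?_
  have := Complex.sq_norm ν
  rw [hν, Complex.normSq_apply, h] at this
  exact Complex.ext h (by simpa using this)

/-- Since `ν` lies on the unit circle and is not `1`, the denominator `ν e^{x/2} - e^{-x/2}` has no
real zero, and it is bounded below by a multiple of `e^{|x|/2}`. -/
lemma exists_le_norm_mul_exp_sub_exp {ν : ℂ} (hν : ‖ν‖ = 1) (hν1 : ν ≠ 1) :
    ∃ ε : ℝ, 0 < ε ∧ ∀ x : ℝ, ε * Real.exp (|x| / 2) ≤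
      ‖ν * (Real.exp (x / 2) : ℂ) - (Real.exp (-(x / 2)) : ℂ)‖ := by
  have hre := re_lt_one_of_norm_eq_one hν hν1
  -- The squared norm `e^x + e^{-x} - 2 Re ν` is at least `(1 - c) (e^x + e^{-x})`.
  set c : ℝ := max ν.re 0
  have hc1 : c < 1 := max_lt hre one_pos
  have hc0 : 0 ≤ c := le_max_right _ _
  refine ⟨√(1 - c), Real.sqrt_pos.2 (by linarith), fun x => ?_⟩
  refine le_of_sq_le_sq ?_ (norm_nonneg _)
  rw [sq_norm_mul_exp_sub_exp hν, mul_pow, Real.sq_sqrt (by linarith), ← Real.exp_nat_mul]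
  have h2 : Real.exp (((2 : ℕ) : ℝ) * (|x| / 2)) ≤ Real.exp x + Real.exp (-x) := by
    have : ((2 : ℕ) : ℝ) * (|x| / 2) = |x| := by push_cast; ring
    rw [this]
    exact Real.exp_abs_le x
  have h3 : 2 ≤ Real.exp x + Real.exp (-x) := by
    have := Real.add_one_le_exp x
    have := Real.add_one_le_exp (-x)
    linarith
  have h4 : ν.re ≤ c := le_max_left _ _
  nlinarith

/-- The function `x ↦ 1 / (ν e^{x/2} - e^{-x/2})`. -/
def expKernel (ν : ℂ) (x : ℝ) : ℂ :=
  1 / (ν * (Real.exp (x / 2) : ℂ) - (Real.exp (-(x / 2)) : ℂ))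

/-- The function `x ↦ (ν e^{x/2} + e^{-x/2}) / (ν e^{x/2} - e^{-x/2})`, in terms of which the
derivatives of `expKernel ν` are expressed. -/
def expKernelRatio (ν : ℂ) (x : ℝ) : ℂ :=
  (ν * (Real.exp (x / 2) : ℂ) + (Real.exp (-(x / 2)) : ℂ)) /
    (ν * (Real.exp (x / 2) : ℂ) - (Real.exp (-(x / 2)) : ℂ))

lemma mul_exp_sub_exp_ne_zero {ν : ℂ} (hν : ‖ν‖ = 1) (hν1 : ν ≠ 1) (x : ℝ) :
    ν * (Real.exp (x / 2) : ℂ) - (Real.exp (-(x / 2)) : ℂ) ≠ 0 := by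
  obtain ⟨ε, hε, h⟩ := exists_le_norm_mul_exp_sub_exp hν hν1
  exact norm_pos_iff.1 (lt_of_lt_of_le (by positivity) (h x))

lemma contDiff_expKernel {ν : ℂ} (hν : ‖ν‖ = 1) (hν1 : ν ≠ 1) : ContDiff ℝ ∞ (expKernel ν) := by
  have h1 : ContDiff ℝ ∞ fun x : ℝ =>
      ν * (Real.exp (x / 2) : ℂ) - (Real.exp (-(x / 2)) : ℂ) := by
    have a1 : ContDiff ℝ ∞ fun x : ℝ => (Real.exp (x / 2) : ℂ) :=
      Complex.ofRealCLM.contDiff.comp (Real.contDiff_exp.comp (by fun_prop))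
    have a2 : ContDiff ℝ ∞ fun x : ℝ => (Real.exp (-(x / 2)) : ℂ) :=
      Complex.ofRealCLM.contDiff.comp (Real.contDiff_exp.comp (by fun_prop))
    exact (contDiff_const.mul a1).sub a2
  have h2 := h1.inv (mul_exp_sub_exp_ne_zero hν hν1)
  have h3 : expKernel ν = (fun x : ℝ =>
      ν * (Real.exp (x / 2) : ℂ) - (Real.exp (-(x / 2)) : ℂ))⁻¹ := by
    funext x
    simp [expKernel]
  rwa [h3]

lemma hasDerivAt_ofReal_exp_half (x : ℝ) :
    HasDerivAt (fun x : ℝ => (Real.exp (x / 2) : ℂ)) ((Real.exp (x / 2) : ℂ) / 2) x := by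
  refine (((hasDerivAt_id x).div_const 2).exp).ofReal_comp.congr_deriv ?_
  simp [div_eq_mul_inv]

lemma hasDerivAt_ofReal_exp_neg_half (x : ℝ) :
    HasDerivAt (fun x : ℝ => (Real.exp (-(x / 2)) : ℂ)) (-(Real.exp (-(x / 2)) : ℂ) / 2) x := by
  refine (((hasDerivAt_id x).div_const 2).fun_neg.exp).ofReal_comp.congr_deriv ?_
  simp [div_eq_mul_inv]

lemma hasDerivAt_expKernel {ν : ℂ} (hν : ‖ν‖ = 1) (hν1 : ν ≠ 1) (x : ℝ) :
    HasDerivAt (expKernel ν) (-(1 / 2) * expKernelRatio ν x * expKernel ν x) x := by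
  have h0 := mul_exp_sub_exp_ne_zero hν hν1 x
  have hD := ((hasDerivAt_ofReal_exp_half x).const_mul ν).fun_sub (hasDerivAt_ofReal_exp_neg_half x)
  refine (HasDerivAt.fun_div (hasDerivAt_const x (1 : ℂ)) hD h0).congr_deriv ?_
  simp only [expKernelRatio, expKernel]
  generalize (Real.exp (x / 2) : ℂ) = u at *
  generalize (Real.exp (-(x / 2)) : ℂ) = v at *
  field_simp
  ring

lemma hasDerivAt_expKernelRatio {ν : ℂ} (hν : ‖ν‖ = 1) (hν1 : ν ≠ 1) (x : ℝ) :
    HasDerivAt (expKernelRatio ν) ((1 / 2) * (1 - expKernelRatio ν x ^ 2)) x := by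
  have h0 := mul_exp_sub_exp_ne_zero hν hν1 x
  have hN := ((hasDerivAt_ofReal_exp_half x).const_mul ν).fun_add (hasDerivAt_ofReal_exp_neg_half x)
  have hD := ((hasDerivAt_ofReal_exp_half x).const_mul ν).fun_sub (hasDerivAt_ofReal_exp_neg_half x)
  refine (hN.fun_div hD h0).congr_deriv ?_
  simp only [expKernelRatio]
  generalize (Real.exp (x / 2) : ℂ) = u at *
  generalize (Real.exp (-(x / 2)) : ℂ) = v at *
  field_simp
  ring

/-- Every derivative of `expKernel ν` is `expKernel ν` times a polynomial in the bounded function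
`expKernelRatio ν`. -/
lemma exists_iteratedDeriv_expKernel {ν : ℂ} (hν : ‖ν‖ = 1) (hν1 : ν ≠ 1) (n : ℕ) :
    ∃ p : Polynomial ℂ, iteratedDeriv n (expKernel ν) =
      fun x => expKernel ν x * p.eval (expKernelRatio ν x) := by
  induction n with
  | zero => exact ⟨1, by simp⟩
  | succ n ih =>
    obtain ⟨p, hp⟩ := ih
    refine ⟨Polynomial.C (-(1 / 2)) * Polynomial.X * p +
      Polynomial.C (1 / 2) * (1 - Polynomial.X ^ 2) * Polynomial.derivative p, ?_⟩
    rw [iteratedDeriv_succ, hp]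
    funext x
    have h1 : HasDerivAt (fun x => p.eval (expKernelRatio ν x)) _ x :=
      (p.hasDerivAt (expKernelRatio ν x)).comp x (hasDerivAt_expKernelRatio hν hν1 x)
    rw [((hasDerivAt_expKernel hν hν1 x).fun_mul h1).deriv]
    simp
    ring

lemma exists_norm_expKernelRatio_le {ν : ℂ} (hν : ‖ν‖ = 1) (hν1 : ν ≠ 1) :
    ∃ R : ℝ, ∀ x, ‖expKernelRatio ν x‖ ≤ R := by
  obtain ⟨ε, hε, h⟩ := exists_le_norm_mul_exp_sub_exp hν hν1
  refine ⟨2 / ε, fun x => ?_⟩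
  rw [expKernelRatio, norm_div, div_le_div_iff₀ (norm_pos_iff.2 (mul_exp_sub_exp_ne_zero hν hν1 x))
    hε]
  have h1 : ‖ν * (Real.exp (x / 2) : ℂ) + (Real.exp (-(x / 2)) : ℂ)‖ ≤ 2 * Real.exp (|x| / 2) := by
    refine (norm_add_le _ _).trans ?_
    rw [norm_mul, hν, Complex.norm_real, Complex.norm_real, Real.norm_of_nonneg (by positivity),
      Real.norm_of_nonneg (by positivity)]
    have : Real.exp (x / 2) ≤ Real.exp (|x| / 2) :=
      Real.exp_le_exp.2 (by linarith [le_abs_self x])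
    have : Real.exp (-(x / 2)) ≤ Real.exp (|x| / 2) :=
      Real.exp_le_exp.2 (by linarith [neg_abs_le x])
    linarith
  nlinarith [h x]

/-- The function `x ↦ 1 / (ν e^{x/2} - e^{-x/2})` is a Schwartz function. -/
lemma exists_schwartzMap_eq_expKernel {ν : ℂ} (hν : ‖ν‖ = 1) (hν1 : ν ≠ 1) :
    ∃ H : 𝓢(ℝ, ℂ), ∀ x, H x = expKernel ν x := by
  refine ⟨⟨expKernel ν, contDiff_expKernel hν hν1, fun k n => ?_⟩, fun x => rfl⟩
  obtain ⟨p, hp⟩ := exists_iteratedDeriv_expKernel hν hν1 n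
  obtain ⟨R, hR⟩ := exists_norm_expKernelRatio_le hν hν1
  obtain ⟨ε, hε, h⟩ := exists_le_norm_mul_exp_sub_exp hν hν1
  obtain ⟨B, hB⟩ := (isCompact_closedBall (0 : ℂ) R).exists_bound_of_continuousOn
    p.continuous.continuousOn
  have hB' : ∀ x, ‖p.eval (expKernelRatio ν x)‖ ≤ B := fun x => hB _ (by simpa using hR x)
  refine ⟨2 ^ k * k ! * ε⁻¹ * B, fun x => ?_⟩
  rw [norm_iteratedFDeriv_eq_norm_iteratedDeriv, hp, norm_mul, ← mul_assoc]
  refine mul_le_mul ?_ (hB' x) (norm_nonneg _) (by positivity)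
  have h1 : ‖expKernel ν x‖ ≤ ε⁻¹ * (Real.exp (|x| / 2))⁻¹ := by
    rw [expKernel, norm_div, norm_one, one_div, ← mul_inv]
    exact inv_anti₀ (by positivity) (h x)
  have h2 : ‖x‖ ^ k ≤ 2 ^ k * k ! * Real.exp (|x| / 2) := by
    have := Real.pow_div_factorial_le_exp (|x| / 2) (by positivity) k
    rw [div_le_iff₀ (by positivity), div_pow, div_le_iff₀ (by positivity)] at this
    rw [Real.norm_eq_abs]
    linarith
  calc ‖x‖ ^ k * ‖expKernel ν x‖
      ≤ (2 ^ k * k ! * Real.exp (|x| / 2)) * (ε⁻¹ * (Real.exp (|x| / 2))⁻¹) := by gcongr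
    _ = 2 ^ k * k ! * ε⁻¹ := by field_simp

/-- The line `Re z = 1/2`, parametrized so that `exp (-x z)` is a Fourier character in `y`. -/
def halfLine (y : ℝ) : ℂ := 1 / 2 + 2 * Real.pi * y * Complex.I

/-- The geometric series `∑ m ≥ 1, (μ e^{-x})^m` is a superposition, with a rapidly decreasing
density that does not depend on `x`, of the exponentials `e^{-xz}` with `Re z = 1/2`: multiplied by
`e^{x/2}`, its sum is a Schwartz function of `x`, to which Fourier inversion applies. -/
lemma exists_schwartzMap_hasSum {μ : ℂ} (hμ : ‖μ‖ = 1) (hμ1 : μ ≠ 1) :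
    ∃ K : 𝓢(ℝ, ℂ), ∀ x : ℝ, 0 < x → HasSum (fun m : ℕ => (μ * Complex.exp (-x)) ^ (m + 1))
      (∫ y, K y * Complex.exp (-(x * halfLine y))) := by
  have hμ0 : μ ≠ 0 := norm_pos_iff.1 (by rw [hμ]; exact one_pos)
  obtain ⟨H, hH⟩ := exists_schwartzMap_eq_expKernel (ν := μ⁻¹) (by simp [hμ]) (by simpa using hμ1)
  refine ⟨𝓕⁻ H, fun x hx => ?_⟩
  have hF : ∫ y, (𝓕⁻ H) y * Complex.exp (-(x * halfLine y)) =
      Complex.exp (-(x / 2)) * expKernel μ⁻¹ x := by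
    have h1 : expKernel μ⁻¹ x = 𝓕 ((𝓕⁻ H : 𝓢(ℝ, ℂ)) : ℝ → ℂ) x := by
      rw [← SchwartzMap.fourier_coe, FourierTransform.fourier_fourierInv_eq, hH]
    rw [h1, Real.fourier_real_eq_integral_exp_smul, ← MeasureTheory.integral_const_mul]
    congr 1
    funext y
    rw [smul_eq_mul, ← mul_assoc, ← Complex.exp_add, mul_comm]
    congr 2
    rw [halfLine]
    push_cast
    ring
  have hlt : ‖μ * Complex.exp (-x)‖ < 1 := by
    rw [norm_mul, hμ, one_mul, Complex.norm_exp]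
    simpa using hx
  rw [hF]
  have hs := (hasSum_geometric_of_norm_lt_one hlt).mul_left (μ * Complex.exp (-x))
  simp only [← pow_succ'] at hs
  refine (congrArg (HasSum _) ?_).mpr hs
  · have h0 := mul_exp_sub_exp_ne_zero (ν := μ⁻¹) (by simp [hμ]) (by simpa using hμ1) x
    have h2 : 1 - μ * Complex.exp (-x) ≠ 0 := by
      intro h
      rw [sub_eq_zero] at h
      rw [← h] at hlt
      simp at hlt
    simp only [expKernel]
    push_cast at h0 ⊢
    have e1 : Complex.exp (-x) = Complex.exp (-(x / 2)) * Complex.exp (-(x / 2)) := by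
      rw [← Complex.exp_add]; ring_nf
    have e2 : Complex.exp (x / 2) * Complex.exp (-(x / 2)) = 1 := by
      rw [← Complex.exp_add]; simp
    rw [e1] at h2 ⊢
    generalize Complex.exp (x / 2) = u at *
    generalize Complex.exp (-(x / 2)) = v at *
    rw [mul_one_div, div_eq_iff h0, mul_assoc, ← div_eq_inv_mul, mul_div_assoc', eq_div_iff h2]
    field_simp
    linear_combination (-v) * e2

end

/-! ### Gamma integrals with a complex parameter -/

lemma integrableOn_rpow_mul_exp_neg_mul {a r : ℝ} (ha : 0 < a) (hr : 0 < r) :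
    IntegrableOn (fun t : ℝ => t ^ (a - 1) * Real.exp (-(r * t))) (Ioi 0) := by
  have h := integrableOn_rpow_mul_exp_neg_mul_rpow (p := 1) (s := a - 1) (by linarith) one_pos hr
  simpa [neg_mul] using h

lemma norm_cpow_mul_exp_neg_mul {t : ℝ} (ht : 0 < t) (a r : ℂ) :
    ‖(t : ℂ) ^ (a - 1) * Complex.exp (-(r * t))‖ =
      t ^ (a.re - 1) * Real.exp (-(r.re * t)) := by
  rw [norm_mul, Complex.norm_cpow_eq_rpow_re_of_pos ht, Complex.norm_exp]
  simp

lemma aestronglyMeasurable_cpow_mul_exp_neg_mul (a r : ℂ) :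
    AEStronglyMeasurable (fun t : ℝ => (t : ℂ) ^ (a - 1) * Complex.exp (-(r * t)))
      (volume.restrict (Ioi 0)) := by
  have : Measurable fun t : ℝ => (t : ℂ) ^ (a - 1) * Complex.exp (-(r * t)) := by fun_prop
  exact this.aestronglyMeasurable

lemma integrableOn_cpow_mul_exp_neg_mul {a r : ℂ} (ha : 0 < a.re) (hr : 0 < r.re) :
    IntegrableOn (fun t : ℝ => (t : ℂ) ^ (a - 1) * Complex.exp (-(r * t))) (Ioi 0) := by
  refine (integrableOn_rpow_mul_exp_neg_mul ha hr).mono'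
    (aestronglyMeasurable_cpow_mul_exp_neg_mul a r) ?_
  filter_upwards [ae_restrict_mem measurableSet_Ioi] with t ht
  exact (norm_cpow_mul_exp_neg_mul ht a r).le

lemma differentiableOn_integral_cpow_mul_exp_neg_mul {a : ℂ} (ha : 0 < a.re) :
    DifferentiableOn ℂ (fun r : ℂ => ∫ t in Ioi (0 : ℝ), (t : ℂ) ^ (a - 1) * Complex.exp (-(r * t)))
      {r | 0 < r.re} := by
  intro r₀ hr₀
  have hr₀' : 0 < r₀.re := hr₀
  have hs : {r : ℂ | r₀.re / 2 < r.re} ∈ nhds r₀ :=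
    (isOpen_lt continuous_const Complex.continuous_re).mem_nhds (by simpa using half_lt_self hr₀')
  refine (hasDerivAt_integral_of_dominated_loc_of_deriv_le (μ := volume.restrict (Ioi (0 : ℝ)))
    (F' := fun r t => (t : ℂ) ^ (a - 1) * (Complex.exp (-(r * t)) * (-t)))
    (bound := fun t => t ^ ((a.re + 1) - 1) * Real.exp (-(r₀.re / 2 * t))) hs
    (Filter.Eventually.of_forall fun r => aestronglyMeasurable_cpow_mul_exp_neg_mul a r)
    (integrableOn_cpow_mul_exp_neg_mul ha hr₀) ?_ ?_
    (integrableOn_rpow_mul_exp_neg_mul (by linarith) (by linarith))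
    ?_).2.differentiableAt.differentiableWithinAt
  · have : Measurable fun t : ℝ => (t : ℂ) ^ (a - 1) * (Complex.exp (-(r₀ * t)) * (-t)) := by
      fun_prop
    exact this.aestronglyMeasurable
  · filter_upwards [ae_restrict_mem measurableSet_Ioi] with t ht r hr
    have ht' : 0 < t := ht
    rw [← mul_assoc, norm_mul, norm_cpow_mul_exp_neg_mul ht, norm_neg, Complex.norm_real,
      Real.norm_of_nonneg ht'.le, mul_right_comm, add_sub_right_comm, Real.rpow_add_one ht'.ne']
    have : r₀.re / 2 ≤ r.re := le_of_lt hr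
    gcongr
  · refine Filter.Eventually.of_forall fun t r _ => ?_
    have h1 : HasDerivAt (fun r : ℂ => -(r * t)) (-(t : ℂ)) r := by
      simpa using ((hasDerivAt_id r).mul_const (t : ℂ)).fun_neg
    exact (h1.cexp).const_mul _

/-- The formula `∫ t^(a-1) e^(-rt) dt = Γ(a) r^(-a)`, known for `r > 0`, holds on the half plane
`Re r > 0` by analytic continuation. -/
lemma integral_cpow_mul_exp_neg_mul_of_re_pos {a r : ℂ} (ha : 0 < a.re) (hr : 0 < r.re) :
    ∫ t in Ioi (0 : ℝ), (t : ℂ) ^ (a - 1) * Complex.exp (-(r * t)) =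
      Complex.Gamma a * r ^ (-a) := by
  have hU : IsOpen {r : ℂ | 0 < r.re} := isOpen_lt continuous_const Complex.continuous_re
  have hf := (differentiableOn_integral_cpow_mul_exp_neg_mul ha).analyticOnNhd hU
  have hg : AnalyticOnNhd ℂ (fun r : ℂ => Complex.Gamma a * r ^ (-a)) {r : ℂ | 0 < r.re} := by
    refine DifferentiableOn.analyticOnNhd (fun r hr => ?_) hU
    exact ((differentiableAt_id.cpow_const (Or.inl hr)).const_mul _).differentiableWithinAt
  have hconn : IsPreconnected {r : ℂ | 0 < r.re} :=
    (convex_halfSpace_re_gt 0).isPreconnected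
  -- Agreement on the positive axis suffices; the points `1 + 1/(n + 1)` accumulate at `1`.
  refine hf.eqOn_of_preconnected_of_frequently_eq hg hconn (z₀ := 1) (by simp) ?_ hr
  have hpos : ∀ x : ℝ, 0 < x →
      ∫ t in Ioi (0 : ℝ), (t : ℂ) ^ (a - 1) * Complex.exp (-((x : ℂ) * t)) =
        Complex.Gamma a * (x : ℂ) ^ (-a) := fun x hx => by
    rw [Complex.integral_cpow_mul_exp_neg_mul_Ioi ha hx, mul_comm, one_div,
      Complex.inv_cpow _ _ (by
        rw [Complex.arg_ofReal_of_nonneg hx.le]; exact Real.pi_pos.ne), Complex.cpow_neg]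
  have htend : Filter.Tendsto (fun n : ℕ => (((1 + 1 / ((n : ℝ) + 1) : ℝ)) : ℂ)) Filter.atTop
      (nhdsWithin 1 {1}ᶜ) := by
    refine tendsto_nhdsWithin_iff.2 ⟨?_, Filter.Eventually.of_forall fun n => ?_⟩
    · have h := (tendsto_one_div_add_atTop_nhds_zero_nat (𝕜 := ℝ)).const_add 1
      rw [add_zero] at h
      exact_mod_cast (Complex.continuous_ofReal.tendsto 1).comp h
    · have : (0 : ℝ) < 1 / ((n : ℝ) + 1) := by positivity
      simp only [mem_compl_iff, mem_singleton_iff]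
      intro h
      have h' : (1 + 1 / ((n : ℝ) + 1) : ℝ) = 1 := by exact_mod_cast h
      linarith
  exact htend.frequently (Filter.Frequently.of_forall fun n => hpos _ (by positivity))

/-! ### Sums of products over a product of copies of `ℕ` -/

lemma pi_count_nat (σ : Type*) [Fintype σ] :
    Measure.pi (fun _ : σ => (Measure.count : Measure ℕ)) = Measure.count := by
  refine Measure.ext_of_singleton fun m => ?_
  rw [Measure.pi_singleton]
  simp

lemma summable_norm_prod {σ : Type*} [Fintype σ] {f : σ → ℕ → ℂ}
    (hf : ∀ n, Summable fun k => ‖f n k‖) : Summable fun m : σ → ℕ => ‖∏ n, f n (m n)‖ := by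
  rw [← integrable_count_iff, ← pi_count_nat]
  exact Integrable.fintype_prod fun n => integrable_count_iff.2 (hf n)

lemma hasSum_prod_tsum {σ : Type*} [Fintype σ] {f : σ → ℕ → ℂ}
    (hf : ∀ n, Summable fun k => ‖f n k‖) :
    HasSum (fun m : σ → ℕ => ∏ n, f n (m n)) (∏ n, ∑' k, f n k) := by
  have h := summable_norm_prod hf
  have h1 : ∫ m, ∏ n, f n (m n) ∂(Measure.count : Measure (σ → ℕ)) =
      ∑' m : σ → ℕ, ∏ n, f n (m n) := by
    rw [integral_countable (integrable_count_iff.2 h)]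
    simp
  have h2 := integral_fintype_prod_eq_prod (𝕜 := ℂ) f
    (μ := fun _ : σ => (Measure.count : Measure ℕ))
  rw [pi_count_nat, h1] at h2
  rw [(h.of_norm).hasSum_iff, h2]
  refine Finset.prod_congr rfl fun n _ => ?_
  rw [integral_countable (integrable_count_iff.2 (hf n))]
  simp

/-! ### Entire functions given by integrals of exponentials -/

/-- An integral of exponentials of linear functionals is an entire function, as soon as the
exponentials of all multiples of the norm of the functional are integrable. -/
lemma differentiable_integral_mul_exp {α E : Type*} [MeasurableSpace α] {m : Measure α}
    [NormedAddCommGroup E] [NormedSpace ℂ E] {w : α → ℂ} {A : α → E →L[ℂ] ℂ}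
    (hw : AEStronglyMeasurable w m) (hA : AEStronglyMeasurable A m)
    (hint : ∀ R : ℝ, Integrable (fun y => ‖w y‖ * Real.exp (R * ‖A y‖)) m) :
    Differentiable ℂ fun s => ∫ y, w y * Complex.exp (A y s) ∂m := by
  have hAs : ∀ s, AEStronglyMeasurable (fun y => A y s) m := fun s =>
    (ContinuousLinearMap.apply ℂ ℂ s).continuous.comp_aestronglyMeasurable hA
  have hmeas : ∀ s, AEStronglyMeasurable (fun y => w y * Complex.exp (A y s)) m := fun s =>
    hw.mul (Complex.continuous_exp.comp_aestronglyMeasurable (hAs s))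
  have hle : ∀ s (R : ℝ), ‖s‖ ≤ R → ∀ y, ‖w y * Complex.exp (A y s)‖ ≤
      ‖w y‖ * Real.exp (R * ‖A y‖) := fun s R hR y => by
    rw [norm_mul]
    refine mul_le_mul_of_nonneg_left ?_ (norm_nonneg _)
    refine (Complex.norm_exp_le_exp_norm _).trans (Real.exp_le_exp.2 ?_)
    rw [mul_comm]
    exact (A y).le_of_opNorm_le_of_le le_rfl hR
  intro s₀
  refine (hasFDerivAt_integral_of_dominated_of_fderiv_le (𝕜 := ℂ) (s := Metric.ball s₀ 1)
    (bound := fun y => ‖w y‖ * Real.exp ((‖s₀‖ + 2) * ‖A y‖))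
    (F' := fun s y => (w y * Complex.exp (A y s)) • A y)
    (Metric.ball_mem_nhds s₀ one_pos) (Filter.Eventually.of_forall hmeas)
    ((hint ‖s₀‖).mono' (hmeas s₀) (Filter.Eventually.of_forall (hle s₀ _ le_rfl)))
    ((hmeas s₀).smul hA) (Filter.Eventually.of_forall fun y s hs => ?_) (hint _)
    (Filter.Eventually.of_forall fun y s _ => ?_)).differentiableAt
  · have hs' : ‖s‖ ≤ ‖s₀‖ + 1 := by
      have := norm_sub_norm_le s s₀
      rw [mem_ball_iff_norm] at hs
      linarith
    rw [norm_smul]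
    have h1 : ‖A y‖ ≤ Real.exp ‖A y‖ := by linarith [Real.add_one_le_exp ‖A y‖]
    calc ‖w y * Complex.exp (A y s)‖ * ‖A y‖
        ≤ (‖w y‖ * Real.exp ((‖s₀‖ + 1) * ‖A y‖)) * Real.exp ‖A y‖ := by
          gcongr
          exact hle s _ hs' y
      _ = _ := by rw [mul_assoc, ← Real.exp_add]; ring_nf
  · have := ((A y).hasFDerivAt (x := s)).cexp.const_mul (w y)
    rwa [smul_smul] at this

/-! ### Affine forms -/

/-- The value at a complex point `z` of the affine form with constant term `d` and coefficients
`c`. -/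
def affineValue {σ : Type*} [Fintype σ] (d : ℝ) (c : σ → ℝ) (z : σ → ℂ) : ℂ :=
  d + ∑ n, c n * z n

/-- The affine forms `d t + ∑ n, c t n X_n` have nonnegative coefficients, none of them is zero, and
each variable occurs in one of them. -/
structure AffineAdmissible {σ τ : Type*} (d : τ → ℝ) (c : τ → σ → ℝ) : Prop where
  const_nonneg : ∀ t, 0 ≤ d t
  coeff_nonneg : ∀ t n, 0 ≤ c t n
  ne_zero : ∀ t, 0 < d t ∨ ∃ n, 0 < c t n
  occurs : ∀ n, ∃ t, 0 < c t n

section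

variable {σ τ : Type*} [Fintype σ]

lemma re_affineValue (d : ℝ) (c : σ → ℝ) (z : σ → ℂ) :
    (affineValue d c z).re = d + ∑ n, c n * (z n).re := by
  simp [affineValue]

lemma measurable_affineValue (d : ℝ) (c : σ → ℝ) : Measurable (affineValue d c) := by
  unfold affineValue
  fun_prop

lemma AffineAdmissible.add_sum_pos {d : τ → ℝ} {c : τ → σ → ℝ} (h : AffineAdmissible d c) (t : τ)
    {w : σ → ℝ} (hw : ∀ n, 0 < w n) : 0 < d t + ∑ n, c t n * w n := by
  rcases h.ne_zero t with hd | ⟨n, hn⟩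
  · exact add_pos_of_pos_of_nonneg hd
      (Finset.sum_nonneg fun n _ => mul_nonneg (h.coeff_nonneg t n) (hw n).le)
  · exact add_pos_of_nonneg_of_pos (h.const_nonneg t)
      (Finset.sum_pos' (fun n _ => mul_nonneg (h.coeff_nonneg t n) (hw n).le)
        ⟨n, Finset.mem_univ _, mul_pos hn (hw n)⟩)

lemma AffineAdmissible.re_affineValue_pos {d : τ → ℝ} {c : τ → σ → ℝ} (h : AffineAdmissible d c)
    (t : τ) {z : σ → ℂ} (hz : ∀ n, 0 < (z n).re) : 0 < (affineValue (d t) (c t) z).re := by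
  rw [re_affineValue]
  exact h.add_sum_pos t hz

lemma re_halfLine (y : ℝ) : (halfLine y).re = 1 / 2 := by
  simp [halfLine]

lemma norm_halfLine_le (y : ℝ) : ‖halfLine y‖ ≤ 8 * (1 + |y|) := by
  have h : ‖halfLine y‖ ≤ 1 / 2 + 2 * Real.pi * |y| := by
    refine (norm_add_le _ _).trans (le_of_eq ?_)
    simp [abs_of_pos Real.pi_pos]
  nlinarith [Real.pi_le_four, abs_nonneg y]

lemma measurable_halfLine : Measurable halfLine := by
  unfold halfLine
  fun_prop

/-- On the lines `Re z_n = 1/2`, the logarithm of an affine form grows at most logarithmically. -/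
lemma AffineAdmissible.exists_norm_log_le {d : τ → ℝ} {c : τ → σ → ℝ} (h : AffineAdmissible d c)
    (t : τ) : ∃ B : ℝ, ∀ y : σ → ℝ,
      ‖Complex.log (affineValue (d t) (c t) fun n => halfLine (y n))‖ ≤
        B + ∑ n, Real.log (1 + |y n|) := by
  set η : ℝ := d t + ∑ n, c t n * (1 / 2) with hη
  have hη0 : 0 < η := h.add_sum_pos t fun _ => by norm_num
  set D : ℝ := 1 + |d t| + ∑ n, |c t n| * 8 with hD
  have hD0 : 0 < D := by positivity
  refine ⟨|Real.log η| + |Real.log D| + Real.pi, fun y => ?_⟩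
  set v := affineValue (d t) (c t) fun n => halfLine (y n)
  have hP1 : ∀ n, 1 + |y n| ≤ ∏ j, (1 + |y j|) := fun n =>
    (Finset.prod_singleton (fun j => 1 + |y j|) n).symm.trans_le
      (Finset.prod_le_prod_of_subset_of_one_le (Finset.subset_univ _) (fun _ _ => by positivity)
        fun _ _ _ => by simp)
  have hP0 : (1 : ℝ) ≤ ∏ j, (1 + |y j|) :=
    Finset.one_le_prod fun j _ => by simp
  have hlow : η ≤ ‖v‖ := by
    refine le_trans (le_of_eq ?_) (Complex.re_le_norm v)
    rw [re_affineValue]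
    simp [re_halfLine, hη]
  have hup : ‖v‖ ≤ D * ∏ j, (1 + |y j|) := by
    calc ‖v‖ ≤ |d t| + ∑ n, |c t n| * ‖halfLine (y n)‖ := by
          refine (norm_add_le _ _).trans (add_le_add (by simp) ?_)
          refine (norm_sum_le _ _).trans (Finset.sum_le_sum fun n _ => by simp)
      _ ≤ |d t| * ∏ j, (1 + |y j|) + ∑ n, |c t n| * 8 * ∏ j, (1 + |y j|) := by
          refine add_le_add (le_mul_of_one_le_right (abs_nonneg _) hP0) ?_
          refine Finset.sum_le_sum fun n _ => ?_
          rw [mul_assoc]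
          refine mul_le_mul_of_nonneg_left ((norm_halfLine_le _).trans ?_) (abs_nonneg _)
          linarith [hP1 n]
      _ ≤ D * ∏ j, (1 + |y j|) := by
          rw [← Finset.sum_mul, hD]
          linarith
  have hv0 : 0 < ‖v‖ := hη0.trans_le hlow
  have hsum : 0 ≤ ∑ n, Real.log (1 + |y n|) :=
    Finset.sum_nonneg fun n _ => Real.log_nonneg (by simp)
  have h1 : Real.log ‖v‖ ≤ |Real.log D| + ∑ n, Real.log (1 + |y n|) := by
    refine (Real.log_le_log hv0 hup).trans ?_
    rw [Real.log_mul hD0.ne' (by positivity), Real.log_prod fun n _ => by positivity]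
    linarith [le_abs_self (Real.log D)]
  have h2 : -|Real.log η| ≤ Real.log ‖v‖ :=
    (neg_abs_le _).trans (Real.log_le_log hη0 hlow)
  have h3 : |Real.log ‖v‖| ≤ |Real.log η| + |Real.log D| + ∑ n, Real.log (1 + |y n|) := by
    rw [abs_le]
    constructor <;> linarith [abs_nonneg (Real.log η), abs_nonneg (Real.log D)]
  calc ‖Complex.log v‖ ≤ |(Complex.log v).re| + |(Complex.log v).im| :=
        Complex.norm_le_abs_re_add_abs_im _
    _ ≤ _ := by
      rw [Complex.log_re, Complex.log_im]
      linarith [Complex.abs_arg_le_pi v]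

/-! ### The entire function that continues the zeta series -/

variable [Fintype τ]

/-- The linear functional `s ↦ -∑ t, s_t log ℓ_t(z)` whose exponential is `∏ t, ℓ_t(z)^(-s_t)`, at
the point `z` of the product of the lines `Re z_n = 1/2` with parameter `y`. -/
def logFunctional (d : τ → ℝ) (c : τ → σ → ℝ) (y : σ → ℝ) : (τ → ℂ) →L[ℂ] ℂ :=
  ∑ t, (-Complex.log (affineValue (d t) (c t) fun n => halfLine (y n))) •
    ContinuousLinearMap.proj (R := ℂ) (φ := fun _ : τ => ℂ) t

lemma exp_logFunctional {d : τ → ℝ} {c : τ → σ → ℝ} (h : AffineAdmissible d c) (y : σ → ℝ)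
    (s : τ → ℂ) : Complex.exp (logFunctional d c y s) =
      ∏ t, (affineValue (d t) (c t) fun n => halfLine (y n)) ^ (-s t) := by
  rw [logFunctional, sum_apply, Complex.exp_sum]
  refine Finset.prod_congr rfl fun t _ => ?_
  rw [Complex.cpow_def_of_ne_zero]
  · simp
  · intro h0
    have := h.re_affineValue_pos t (z := fun n => halfLine (y n)) fun n => by
      rw [re_halfLine]; norm_num
    rw [h0] at this
    simp at this

lemma measurable_logFunctional (d : τ → ℝ) (c : τ → σ → ℝ) : Measurable (logFunctional d c) := by
  unfold logFunctional
  refine Finset.measurable_sum _ fun t _ => Measurable.smul_const ?_ _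
  refine (Complex.measurable_log.comp ((measurable_affineValue (d t) (c t)).comp ?_)).neg
  exact measurable_pi_lambda _ fun n => measurable_halfLine.comp (measurable_pi_apply n)

lemma AffineAdmissible.exists_norm_logFunctional_le {d : τ → ℝ} {c : τ → σ → ℝ}
    (h : AffineAdmissible d c) : ∃ B : ℝ, ∀ y : σ → ℝ, ‖logFunctional d c y‖ ≤
      B + Fintype.card τ * ∑ n, Real.log (1 + |y n|) := by
  choose B hB using h.exists_norm_log_le
  refine ⟨∑ t, B t, fun y => ?_⟩
  have hproj : ∀ t, ‖ContinuousLinearMap.proj (R := ℂ) (φ := fun _ : τ => ℂ) t‖ ≤ 1 := fun t =>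
    ContinuousLinearMap.opNorm_le_bound _ zero_le_one fun s => by
      rw [one_mul]
      exact norm_le_pi_norm s t
  calc ‖logFunctional d c y‖ ≤ ∑ t, (B t + ∑ n, Real.log (1 + |y n|)) := by
        refine (norm_sum_le _ _).trans (Finset.sum_le_sum fun t _ => ?_)
        rw [norm_smul, norm_neg]
        exact (mul_le_of_le_one_right (norm_nonneg _) (hproj t)).trans (hB t y)
    _ = _ := by
        rw [Finset.sum_add_distrib, Finset.sum_const, Finset.card_univ, nsmul_eq_mul]

lemma integrable_norm_mul_one_add_abs_pow (K : 𝓢(ℝ, ℂ)) (M : ℕ) :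
    Integrable fun y : ℝ => ‖K y‖ * (1 + |y|) ^ M := by
  have h0 := K.integrable_pow_mul volume 0
  have hM := K.integrable_pow_mul volume M
  refine ((h0.add hM).const_mul (2 ^ (M - 1))).mono' ?_ (Filter.Eventually.of_forall fun y => ?_)
  · have : Continuous fun y : ℝ => ‖K y‖ * (1 + |y|) ^ M := by fun_prop
    exact this.aestronglyMeasurable
  · have h1 := add_pow_le (zero_le_one (α := ℝ)) (abs_nonneg y) M
    rw [Real.norm_of_nonneg (by positivity)]
    simp only [Pi.add_apply, Real.norm_eq_abs, pow_zero, one_mul]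
    rw [one_pow] at h1
    calc ‖K y‖ * (1 + |y|) ^ M ≤ ‖K y‖ * (2 ^ (M - 1) * (1 + |y| ^ M)) := by gcongr
      _ = _ := by ring

lemma integrable_norm_prod_mul_exp {d : τ → ℝ} {c : τ → σ → ℝ} (h : AffineAdmissible d c)
    (K : σ → 𝓢(ℝ, ℂ)) (R : ℝ) :
    Integrable fun y : σ → ℝ => ‖∏ n, K n (y n)‖ * Real.exp (R * ‖logFunctional d c y‖) := by
  obtain ⟨B, hB⟩ := h.exists_norm_logFunctional_le
  obtain ⟨M, hM⟩ := exists_nat_ge (|R| * Fintype.card τ)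
  have hprod : Integrable fun y : σ → ℝ => ∏ n, ‖K n (y n)‖ * (1 + |y n|) ^ M :=
    Integrable.fintype_prod (f := fun n y => ‖K n y‖ * (1 + |y|) ^ M)
      fun n => integrable_norm_mul_one_add_abs_pow (K n) M
  refine (hprod.const_mul (Real.exp (|R| * B))).mono' ?_ (Filter.Eventually.of_forall fun y => ?_)
  · have h1 : Measurable fun y : σ → ℝ => ‖∏ n, K n (y n)‖ :=
      (Finset.measurable_prod _ fun n _ =>
        (K n).continuous.measurable.comp (measurable_pi_apply n)).norm
    exact (h1.mul (((measurable_logFunctional d c).norm.const_mul R).exp)).aestronglyMeasurable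
  · have hS : 0 ≤ ∑ n, Real.log (1 + |y n|) :=
      Finset.sum_nonneg fun n _ => Real.log_nonneg (by simp)
    have h1 : R * ‖logFunctional d c y‖ ≤ |R| * B + M * ∑ n, Real.log (1 + |y n|) := by
      calc R * ‖logFunctional d c y‖ ≤ |R| * ‖logFunctional d c y‖ := by
            gcongr; exact le_abs_self R
        _ ≤ |R| * (B + Fintype.card τ * ∑ n, Real.log (1 + |y n|)) := by
            gcongr; exact hB y
        _ = |R| * B + |R| * Fintype.card τ * ∑ n, Real.log (1 + |y n|) := by ring
        _ ≤ _ := by gcongr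
    have h2 : Real.exp (M * ∑ n, Real.log (1 + |y n|)) = ∏ n, (1 + |y n|) ^ M := by
      rw [Finset.mul_sum, Real.exp_sum]
      refine Finset.prod_congr rfl fun n _ => ?_
      rw [Real.exp_nat_mul, Real.exp_log (by positivity)]
    rw [Real.norm_of_nonneg (by positivity), norm_prod, Finset.prod_mul_distrib, ← h2]
    calc (∏ n, ‖K n (y n)‖) * Real.exp (R * ‖logFunctional d c y‖)
        ≤ (∏ n, ‖K n (y n)‖) * Real.exp (|R| * B + M * ∑ n, Real.log (1 + |y n|)) := by gcongr
      _ = _ := by rw [Real.exp_add]; ring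

/-- The integral `∫ ∏ n, K_n(y_n) ∏ t, ℓ_t(z(y))^(-s_t) dy`, where `z(y)` runs through the points
with `Re z_n = 1/2`. Every `ℓ_t(z)` has positive real part there, so that the powers are those of
the principal branch. -/
def zetaIntegral (K : σ → 𝓢(ℝ, ℂ)) (d : τ → ℝ) (c : τ → σ → ℝ) (s : τ → ℂ) : ℂ :=
  ∫ y : σ → ℝ, (∏ n, K n (y n)) *
    ∏ t, (affineValue (d t) (c t) fun n => halfLine (y n)) ^ (-s t)

lemma measurable_prod_schwartzMap (K : σ → 𝓢(ℝ, ℂ)) :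
    Measurable fun y : σ → ℝ => ∏ n, K n (y n) :=
  Finset.measurable_prod _ fun n _ => (K n).continuous.measurable.comp (measurable_pi_apply n)

lemma differentiable_zetaIntegral {d : τ → ℝ} {c : τ → σ → ℝ} (h : AffineAdmissible d c)
    (K : σ → 𝓢(ℝ, ℂ)) : Differentiable ℂ (zetaIntegral K d c) := by
  have := differentiable_integral_mul_exp (m := volume)
    (measurable_prod_schwartzMap K).aestronglyMeasurable
    (measurable_logFunctional d c).aestronglyMeasurable (integrable_norm_prod_mul_exp h K)
  simp only [exp_logFunctional h] at this
  exact this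

lemma integrable_zetaIntegrand {d : τ → ℝ} {c : τ → σ → ℝ} (h : AffineAdmissible d c)
    (K : σ → 𝓢(ℝ, ℂ)) (s : τ → ℂ) : Integrable fun y : σ → ℝ => (∏ n, K n (y n)) *
      ∏ t, (affineValue (d t) (c t) fun n => halfLine (y n)) ^ (-s t) := by
  simp only [← exp_logFunctional h]
  refine (integrable_norm_prod_mul_exp h K ‖s‖).mono' ?_ (Filter.Eventually.of_forall fun y => ?_)
  · refine (measurable_prod_schwartzMap K).aestronglyMeasurable.mul ?_
    exact Complex.continuous_exp.comp_aestronglyMeasurable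
      ((ContinuousLinearMap.apply ℂ ℂ s).continuous.comp_aestronglyMeasurable
        (measurable_logFunctional d c).aestronglyMeasurable)
  · rw [norm_mul]
    refine mul_le_mul_of_nonneg_left ?_ (norm_nonneg _)
    refine (Complex.norm_exp_le_exp_norm _).trans (Real.exp_le_exp.2 ?_)
    rw [mul_comm]
    exact (logFunctional d c y).le_opNorm s

end

/-! ### Summation of the zeta series by Mellin transforms -/

/-- The Schwartz function `K` represents the geometric series of ratio `μ e^{-x}` as a superposition
of exponentials on the line `Re z = 1/2`. -/
def RepresentsGeometric (μ : ℂ) (K : 𝓢(ℝ, ℂ)) : Prop :=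
  ∀ x : ℝ, 0 < x → HasSum (fun m : ℕ => (μ * Complex.exp (-x)) ^ (m + 1))
    (∫ y, K y * Complex.exp (-(x * halfLine y)))

section

variable {σ τ : Type*} [Fintype σ] [Fintype τ]

/-- The integrand `∏ t, x_t^(s_t - 1) e^(-x_t ℓ_t(z))` of the Mellin integral of
`∏ t, ℓ_t(z)^(-s_t)`. -/
def mellinIntegrand (s : τ → ℂ) (d : τ → ℝ) (c : τ → σ → ℝ) (x : τ → ℝ) (z : σ → ℂ) : ℂ :=
  ∏ t, ((x t : ℂ) ^ (s t - 1) * Complex.exp (-(affineValue (d t) (c t) z * x t)))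

lemma mellinIntegrand_eq (s : τ → ℂ) (d : τ → ℝ) (c : τ → σ → ℝ) (x : τ → ℝ) (z : σ → ℂ) :
    mellinIntegrand s d c x z = (∏ t, ((x t : ℂ) ^ (s t - 1) * Complex.exp (-(d t * x t)))) *
      ∏ n, Complex.exp (-((∑ t, c t n * x t : ℝ) * z n)) := by
  rw [mellinIntegrand, Finset.prod_mul_distrib, Finset.prod_mul_distrib, mul_assoc,
    ← Complex.exp_sum, ← Complex.exp_sum, ← Complex.exp_sum, ← Complex.exp_add]
  congr 2
  simp only [affineValue, Finset.sum_neg_distrib, ← neg_add, add_mul, Finset.sum_add_distrib]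
  congr 2
  push_cast
  simp only [Finset.sum_mul]
  rw [Finset.sum_comm]
  exact Finset.sum_congr rfl fun n _ => Finset.sum_congr rfl fun t _ => by ring

/-- Lebesgue measure on the product of the half lines `x_t > 0`. -/
def posMeasure (τ : Type*) [Fintype τ] : Measure (τ → ℝ) :=
  Measure.pi fun _ => volume.restrict (Ioi 0)

instance : SFinite (posMeasure τ) := by
  unfold posMeasure
  infer_instance

lemma ae_posMeasure : ∀ᵐ x ∂posMeasure τ, ∀ t, 0 < x t := by
  rw [posMeasure, ← Measure.restrict_pi_pi]
  filter_upwards [ae_restrict_mem (MeasurableSet.univ_pi fun _ => measurableSet_Ioi)] with x hx t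
  exact hx t (mem_univ t)

lemma integrable_mellinIntegrand {s : τ → ℂ} (hs : ∀ t, 0 < (s t).re) {d : τ → ℝ} {c : τ → σ → ℝ}
    {z : σ → ℂ} (hz : ∀ t, 0 < (affineValue (d t) (c t) z).re) :
    Integrable (fun x => mellinIntegrand s d c x z) (posMeasure τ) :=
  Integrable.fintype_prod (f := fun t (x : ℝ) =>
      (x : ℂ) ^ (s t - 1) * Complex.exp (-(affineValue (d t) (c t) z * x)))
    fun t => integrableOn_cpow_mul_exp_neg_mul (hs t) (hz t)

lemma integral_mellinIntegrand {s : τ → ℂ} (hs : ∀ t, 0 < (s t).re) {d : τ → ℝ} {c : τ → σ → ℝ}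
    {z : σ → ℂ} (hz : ∀ t, 0 < (affineValue (d t) (c t) z).re) :
    ∫ x, mellinIntegrand s d c x z ∂posMeasure τ =
      (∏ t, Complex.Gamma (s t)) * ∏ t, affineValue (d t) (c t) z ^ (-s t) := by
  rw [← Finset.prod_mul_distrib]
  refine (integral_fintype_prod_eq_prod (𝕜 := ℂ) fun t (x : ℝ) =>
    (x : ℂ) ^ (s t - 1) * Complex.exp (-(affineValue (d t) (c t) z * x))).trans ?_
  exact Finset.prod_congr rfl fun t _ => integral_cpow_mul_exp_neg_mul_of_re_pos (hs t) (hz t)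

lemma norm_mellinIntegrand (s : τ → ℂ) (d : τ → ℝ) (c : τ → σ → ℝ) {x : τ → ℝ}
    (hx : ∀ t, 0 < x t) (z : σ → ℂ) : ‖mellinIntegrand s d c x z‖ =
      ∏ t, (x t ^ ((s t).re - 1) * Real.exp (-((affineValue (d t) (c t) z).re * x t))) := by
  rw [mellinIntegrand, norm_prod]
  exact Finset.prod_congr rfl fun t _ => norm_cpow_mul_exp_neg_mul (hx t) _ _

lemma integral_norm_mellinIntegrand {s : τ → ℂ} (hs : ∀ t, 0 < (s t).re) {d : τ → ℝ}
    {c : τ → σ → ℝ} {z : σ → ℂ} (hz : ∀ t, 0 < (affineValue (d t) (c t) z).re) :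
    ∫ x, ‖mellinIntegrand s d c x z‖ ∂posMeasure τ =
      (∏ t, Real.Gamma (s t).re) * ∏ t, (affineValue (d t) (c t) z).re ^ (-(s t).re) := by
  rw [← Finset.prod_mul_distrib]
  have h : ∫ x, ‖mellinIntegrand s d c x z‖ ∂posMeasure τ = ∫ x : τ → ℝ,
      ∏ t, (x t ^ ((s t).re - 1) * Real.exp (-((affineValue (d t) (c t) z).re * x t)))
        ∂posMeasure τ :=
    integral_congr_ae (ae_posMeasure.mono fun x hx => norm_mellinIntegrand s d c hx z)
  rw [h]
  refine (integral_fintype_prod_eq_prod (𝕜 := ℝ) fun t (x : ℝ) =>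
    x ^ ((s t).re - 1) * Real.exp (-((affineValue (d t) (c t) z).re * x))).trans ?_
  refine Finset.prod_congr rfl fun t _ => ?_
  rw [Real.integral_rpow_mul_exp_neg_mul_Ioi (hs t) (hz t), mul_comm, one_div,
    Real.inv_rpow (hz t).le, Real.rpow_neg (hz t).le]

/-- For positive `x_t`, the Mellin integrands at the points with positive integer coordinates sum up
to their integral over the lines `Re z_n = 1/2`: both are products of geometric series. -/
lemma hasSum_mellinIntegrand {μ : σ → ℂ} (hμ : ∀ n, ‖μ n‖ = 1) {K : σ → 𝓢(ℝ, ℂ)}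
    (hK : ∀ n, RepresentsGeometric (μ n) (K n)) {d : τ → ℝ} {c : τ → σ → ℝ}
    (h : AffineAdmissible d c) (s : τ → ℂ) {x : τ → ℝ} (hx : ∀ t, 0 < x t) :
    HasSum (fun m : σ → ℕ => (∏ n, μ n ^ (m n + 1)) *
        mellinIntegrand s d c x fun n => ((m n + 1 : ℕ) : ℂ))
      (∫ y : σ → ℝ, (∏ n, K n (y n)) * mellinIntegrand s d c x fun n => halfLine (y n)) := by
  set w : σ → ℝ := fun n => ∑ t, c t n * x t
  have hw : ∀ n, 0 < w n := fun n => by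
    obtain ⟨t, ht⟩ := h.occurs n
    exact Finset.sum_pos' (fun t _ => mul_nonneg (h.coeff_nonneg t n) (hx t).le)
      ⟨t, Finset.mem_univ _, mul_pos ht (hx t)⟩
  have hsum : ∀ n, Summable fun m : ℕ => ‖(μ n * Complex.exp (-w n)) ^ (m + 1)‖ := fun n => by
    have hlt : ‖μ n * Complex.exp (-w n)‖ < 1 := by
      rw [norm_mul, hμ, one_mul, Complex.norm_exp]
      simpa using hw n
    simp only [norm_pow]
    exact (summable_nat_add_iff 1).2 (summable_geometric_of_lt_one (norm_nonneg _) hlt)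
  have h1 := hasSum_prod_tsum hsum
  have h2 : ∏ n, ∑' m : ℕ, (μ n * Complex.exp (-w n)) ^ (m + 1) =
      ∫ y : σ → ℝ, ∏ n, (K n (y n) * Complex.exp (-(w n * halfLine (y n)))) := by
    rw [integral_fintype_prod_volume_eq_prod
      (f := fun n y => K n y * Complex.exp (-(w n * halfLine y)))]
    exact Finset.prod_congr rfl fun n _ => (hK n (w n) (hw n)).tsum_eq
  rw [h2] at h1
  have h3 := h1.mul_left (∏ t, ((x t : ℂ) ^ (s t - 1) * Complex.exp (-(d t * x t))))
  rw [← integral_const_mul] at h3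
  convert! h3 using 1
  · funext m
    rw [mellinIntegrand_eq, mul_left_comm, ← Finset.prod_mul_distrib]
    congr 1
    refine Finset.prod_congr rfl fun n _ => ?_
    rw [mul_pow, ← Complex.exp_nat_mul]
    congr 2
    ring
  · congr 1
    funext y
    rw [mellinIntegrand_eq, mul_left_comm, ← Finset.prod_mul_distrib]

lemma integrable_prod_mul_mellinIntegrand (K : σ → 𝓢(ℝ, ℂ)) {d : τ → ℝ} {c : τ → σ → ℝ}
    (h : AffineAdmissible d c) {s : τ → ℂ} (hs : ∀ t, 0 < (s t).re) :
    Integrable (fun p : (τ → ℝ) × (σ → ℝ) =>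
        (∏ n, K n (p.2 n)) * mellinIntegrand s d c p.1 fun n => halfLine (p.2 n))
      ((posMeasure τ).prod volume) := by
  have hz : ∀ t, 0 < (affineValue (d t) (c t) fun _ : σ => (1 / 2 : ℂ)).re := fun t =>
    h.re_affineValue_pos t fun _ => by norm_num
  have hre : ∀ t (y : σ → ℝ), (affineValue (d t) (c t) fun n => halfLine (y n)).re =
      (affineValue (d t) (c t) fun _ : σ => (1 / 2 : ℂ)).re := fun t y => by
    rw [re_affineValue, re_affineValue]
    simp [re_halfLine]
  have hK : Integrable (fun y : σ → ℝ => ∏ n, K n (y n)) :=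
    Integrable.fintype_prod (f := fun n => K n) fun n => (K n).integrable
  refine ((integrable_mellinIntegrand hs hz).mul_prod hK).mono ?_ ?_
  · refine Measurable.aestronglyMeasurable (Measurable.mul ?_ ?_)
    · exact (measurable_prod_schwartzMap K).comp measurable_snd
    · refine Finset.measurable_prod _ fun t _ => ?_
      have hx : Measurable fun p : (τ → ℝ) × (σ → ℝ) => ((p.1 t : ℝ) : ℂ) := by fun_prop
      have hv : Measurable fun p : (τ → ℝ) × (σ → ℝ) =>
          affineValue (d t) (c t) fun n => halfLine (p.2 n) :=
        (measurable_affineValue (d t) (c t)).comp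
          (measurable_pi_lambda _ fun n => measurable_halfLine.comp (by fun_prop))
      exact (hx.pow_const _).mul (Complex.measurable_exp.comp (hv.mul hx).neg)
  · filter_upwards [Measure.quasiMeasurePreserving_fst.ae (ae_posMeasure (τ := τ))] with p hp
    rw [norm_mul, norm_mul, norm_mellinIntegrand s d c hp, norm_mellinIntegrand s d c hp, mul_comm]
    simp only [hre]
    exact le_rfl

/-- The sum over all points with positive integer coordinates of `∏ t, ℓ_t(m)^(-σ_t)` converges as
soon as every `σ_t` exceeds twice the number of variables: `ℓ_t(m)` is bounded below by a multiple
of each coordinate that occurs in it. -/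
lemma AffineAdmissible.summable_prod_rpow {d : τ → ℝ} {c : τ → σ → ℝ} (h : AffineAdmissible d c)
    {r : τ → ℝ} (hr : ∀ t, 2 * Fintype.card σ < r t) :
    Summable fun m : σ → ℕ =>
      ∏ t, (affineValue (d t) (c t) fun n => ((m n + 1 : ℕ) : ℂ)).re ^ (-r t) := by
  classical
  choose f hf using h.occurs
  set v : τ → (σ → ℕ) → ℝ := fun t m => d t + ∑ n, c t n * ((m n : ℝ) + 1)
  have hv : ∀ t (m : σ → ℕ), (affineValue (d t) (c t) fun n => ((m n + 1 : ℕ) : ℂ)).re = v t m :=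
    fun t m => by simp [re_affineValue, v]
  simp only [hv]
  set η : τ → ℝ := fun t => d t + ∑ n, c t n * 1
  have hη0 : ∀ t, 0 < η t := fun t => h.add_sum_pos t fun _ => one_pos
  have hηv : ∀ t m, η t ≤ v t m := fun t m => by
    refine add_le_add le_rfl (Finset.sum_le_sum fun n _ => ?_)
    exact mul_le_mul_of_nonneg_left (by simp) (h.coeff_nonneg t n)
  have hv0 : ∀ t m, 0 < v t m := fun t m => (hη0 t).trans_le (hηv t m)
  -- `v t m` dominates a multiple of the coordinate `m n + 1` if `t` is the form chosen for `n`.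
  set ε : τ → σ → ℝ := fun t n => if f n = t then c t n else η t
  set w : τ → σ → (σ → ℕ) → ℝ := fun t n m => if f n = t then (m n : ℝ) + 1 else 1
  have hε0 : ∀ t n, 0 < ε t n := fun t n => by
    simp only [ε]
    split_ifs with hn
    · exact hn ▸ hf n
    · exact hη0 t
  have hw0 : ∀ t n m, 0 < w t n m := fun t n m => by
    simp only [w]
    split_ifs <;> positivity
  have hεw : ∀ t n m, ε t n * w t n m ≤ v t m := fun t n m => by
    simp only [ε, w]
    split_ifs with hn
    · have h1 : c t n * ((m n : ℝ) + 1) ≤ ∑ n, c t n * ((m n : ℝ) + 1) :=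
        Finset.single_le_sum (f := fun n => c t n * ((m n : ℝ) + 1))
          (fun n _ => mul_nonneg (h.coeff_nonneg t n) (by positivity)) (Finset.mem_univ n)
      exact h1.trans (le_add_of_nonneg_left (h.const_nonneg t))
    · simpa using hηv t m
  have hwprod : ∀ m, ∏ t, ∏ n, (w t n m ^ 2)⁻¹ = ∏ n, (((m n : ℝ) + 1) ^ 2)⁻¹ := fun m => by
    rw [Finset.prod_comm]
    refine Finset.prod_congr rfl fun n _ => ?_
    rw [Finset.prod_eq_single (f n) (fun t _ ht => ?_) (by simp)]
    · simp [w]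
    · simp [w, ht.symm]
  have hsq : Summable fun k : ℕ => ‖((((k : ℝ) + 1) ^ 2)⁻¹ : ℂ)‖ := by
    have := (summable_nat_add_iff 1).2 (Real.summable_nat_pow_inv.2 one_lt_two)
    refine this.congr fun k => ?_
    rw [norm_inv, norm_pow]
    norm_cast
  have hbase : Summable fun m : σ → ℕ => ∏ n, (((m n : ℝ) + 1) ^ 2)⁻¹ := by
    refine (summable_norm_prod (f := fun _ : σ => fun k : ℕ => ((((k : ℝ) + 1) ^ 2)⁻¹ : ℂ))
      fun _ => hsq).congr fun m => ?_
    rw [norm_prod]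
    refine Finset.prod_congr rfl fun n _ => ?_
    rw [norm_inv, norm_pow]
    norm_cast
  refine Summable.of_nonneg_of_le
    (fun m => Finset.prod_nonneg fun t _ => Real.rpow_nonneg (hv0 t m).le _) (fun m => ?_)
    (hbase.mul_left (∏ t, (η t ^ (-(r t - 2 * Fintype.card σ)) * ∏ n, (ε t n ^ 2)⁻¹)))
  rw [← hwprod, ← Finset.prod_mul_distrib]
  refine Finset.prod_le_prod (fun t _ => Real.rpow_nonneg (hv0 t m).le _) fun t _ => ?_
  have e1 : v t m ^ (-r t) = v t m ^ (-(r t - 2 * Fintype.card σ)) * ∏ n : σ, (v t m ^ 2)⁻¹ := by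
    rw [Finset.prod_const, Finset.card_univ, inv_pow, ← pow_mul, ← Real.rpow_natCast,
      ← Real.rpow_neg (hv0 t m).le, ← Real.rpow_add (hv0 t m)]
    congr 1
    push_cast
    ring
  rw [e1, mul_assoc, ← Finset.prod_mul_distrib]
  have e2 : v t m ^ (-(r t - 2 * Fintype.card σ)) ≤ η t ^ (-(r t - 2 * Fintype.card σ)) :=
    Real.rpow_le_rpow_of_nonpos (hη0 t) (hηv t m) (by linarith [hr t])
  have e3 : ∏ n : σ, (v t m ^ 2)⁻¹ ≤ ∏ n, ((ε t n ^ 2)⁻¹ * (w t n m ^ 2)⁻¹) := by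
    refine Finset.prod_le_prod (fun n _ => by positivity) fun n _ => ?_
    rw [← mul_inv, ← mul_pow]
    have := mul_pos (hε0 t n) (hw0 t n m)
    exact inv_anti₀ (by positivity) (pow_le_pow_left₀ this.le (hεw t n m) 2)
  refine mul_le_mul e2 e3 (Finset.prod_nonneg fun n _ => by positivity) ?_
  exact Real.rpow_nonneg (hη0 t).le _

/-- When the real parts of the `s_t` are large, the zeta series of admissible affine forms converges
to `zetaIntegral`. -/
lemma hasSum_zetaIntegral {μ : σ → ℂ} (hμ : ∀ n, ‖μ n‖ = 1) {K : σ → 𝓢(ℝ, ℂ)}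
    (hK : ∀ n, RepresentsGeometric (μ n) (K n)) {d : τ → ℝ} {c : τ → σ → ℝ}
    (h : AffineAdmissible d c) {s : τ → ℂ} (hs : ∀ t, 2 * Fintype.card σ < (s t).re) :
    HasSum (fun m : σ → ℕ => (∏ n, μ n ^ (m n + 1)) *
        ∏ t, (affineValue (d t) (c t) fun n => ((m n + 1 : ℕ) : ℂ)) ^ (-s t))
      (zetaIntegral K d c s) := by
  have hs0 : ∀ t, 0 < (s t).re := fun t => lt_of_le_of_lt (by positivity) (hs t)
  have hz : ∀ (m : σ → ℕ) t, 0 < (affineValue (d t) (c t) fun n => ((m n + 1 : ℕ) : ℂ)).re :=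
    fun m t => h.re_affineValue_pos t fun n => by
      rw [Complex.natCast_re]; positivity
  have hzh : ∀ (y : σ → ℝ) t, 0 < (affineValue (d t) (c t) fun n => halfLine (y n)).re :=
    fun y t => h.re_affineValue_pos t fun n => by rw [re_halfLine]; norm_num
  set F : (σ → ℕ) → (τ → ℝ) → ℂ := fun m x => (∏ n, μ n ^ (m n + 1)) *
    mellinIntegrand s d c x fun n => ((m n + 1 : ℕ) : ℂ) with hF
  have hFint : ∀ m, Integrable (F m) (posMeasure τ) := fun m =>
    (integrable_mellinIntegrand hs0 (hz m)).const_mul _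
  have hFsum : Summable fun m => ∫ x, ‖F m x‖ ∂posMeasure τ := by
    refine ((h.summable_prod_rpow hs).mul_left (∏ t, Real.Gamma (s t).re)).congr fun m => ?_
    rw [← integral_norm_mellinIntegrand hs0 (hz m)]
    congr 1
    funext x
    simp [hF, norm_prod, hμ]
  have h1 := hasSum_integral_of_summable_integral_norm hFint hFsum
  have h2 : ∫ x, ∑' m, F m x ∂posMeasure τ =
      (∏ t, Complex.Gamma (s t)) * zetaIntegral K d c s := by
    have e1 : ∫ x, ∑' m, F m x ∂posMeasure τ = ∫ x, (∫ y : σ → ℝ, (∏ n, K n (y n)) *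
        mellinIntegrand s d c x fun n => halfLine (y n)) ∂posMeasure τ :=
      integral_congr_ae (ae_posMeasure.mono fun x hx =>
        (hasSum_mellinIntegrand hμ hK h s hx).tsum_eq)
    rw [e1, integral_integral_swap (integrable_prod_mul_mellinIntegrand K h hs0), zetaIntegral,
      ← integral_const_mul]
    congr 1
    funext y
    rw [integral_const_mul, integral_mellinIntegrand hs0 (hzh y)]
    ring
  rw [h2] at h1
  have hΓ : ∏ t, Complex.Gamma (s t) ≠ 0 :=
    Finset.prod_ne_zero_iff.2 fun t _ => Complex.Gamma_ne_zero_of_re_pos (hs0 t)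
  have h3 := h1.mul_left (∏ t, Complex.Gamma (s t))⁻¹
  rw [inv_mul_cancel_left₀ hΓ] at h3
  refine h3.congr_fun fun m => ?_
  simp only [hF]
  rw [integral_const_mul, integral_mellinIntegrand hs0 (hz m), mul_left_comm,
    inv_mul_cancel_left₀ hΓ]

end

/-! ### Zeta series of affine polynomials -/

/-- The polynomial `d + ∑ n, c n X_n`. -/
def affinePoly {σ : Type*} [Fintype σ] (d : ℝ) (c : σ → ℝ) : MvPolynomial σ ℝ :=
  C d + ∑ n, C (c n) * X n

section

variable {σ τ : Type*} [Fintype σ]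

lemma eval_affinePoly (d : ℝ) (c : σ → ℝ) (x : σ → ℝ) :
    eval x (affinePoly d c) = d + ∑ n, c n * x n := by
  simp [affinePoly]

lemma ofReal_eval_affinePoly (d : ℝ) (c : σ → ℝ) (m : σ → ℕ) :
    ((eval (fun n => (m n : ℝ)) (affinePoly d c) : ℝ) : ℂ) =
      affineValue d c fun n => (m n : ℂ) := by
  simp [eval_affinePoly, affineValue]

lemma coeff_affinePoly_single (d : ℝ) (c : σ → ℝ) (n : σ) :
    (affinePoly d c).coeff (Finsupp.single n 1) = c n := by
  classical
  have h0 : (0 : σ →₀ ℕ) ≠ Finsupp.single n 1 := (Finsupp.single_ne_zero.2 one_ne_zero).symm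
  simp [affinePoly, coeff_sum, coeff_C_mul, coeff_C, coeff_X, Finsupp.single_left_inj, h0]

lemma coeff_affinePoly_nonneg {d : ℝ} {c : σ → ℝ} (hd : 0 ≤ d) (hc : ∀ n, 0 ≤ c n) (α : σ →₀ ℕ) :
    0 ≤ (affinePoly d c).coeff α := by
  classical
  simp only [affinePoly, coeff_add, coeff_sum, coeff_C_mul, coeff_C, coeff_X]
  refine add_nonneg (by split_ifs <;> simp [hd]) (Finset.sum_nonneg fun n _ => ?_)
  exact mul_nonneg (hc n) (by split_ifs <;> simp)

lemma totalDegree_affinePoly_le (d : ℝ) (c : σ → ℝ) : (affinePoly d c).totalDegree ≤ 1 := by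
  refine (totalDegree_add _ _).trans (max_le (by simp) ?_)
  refine totalDegree_finsetSum_le fun n _ => (totalDegree_mul _ _).trans ?_
  simp

lemma mem_vars_affinePoly {d : ℝ} {c : σ → ℝ} {n : σ} :
    n ∈ (affinePoly d c).vars ↔ c n ≠ 0 := by
  classical
  constructor
  · intro h hn
    have h1 := vars_add_subset _ _ h
    rw [vars_C, Finset.empty_union] at h1
    obtain ⟨j, -, hj⟩ := Finset.mem_biUnion.1 (vars_sum_subset _ _ h1)
    have h2 := vars_mul _ _ hj
    rw [vars_C, Finset.empty_union, vars_X, Finset.mem_singleton] at h2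
    subst h2
    simp [hn] at hj
  · intro h
    rw [mem_vars_iff_mem_support]
    exact ⟨Finsupp.single n 1, by rwa [mem_support_iff, coeff_affinePoly_single], by simp⟩

lemma affinePoly_ne_zero {d : τ → ℝ} {c : τ → σ → ℝ} (h : AffineAdmissible d c) (t : τ) :
    affinePoly (d t) (c t) ≠ 0 := fun h0 => by
  have h1 := eval_affinePoly (d t) (c t) fun _ => 1
  rw [h0, map_zero] at h1
  exact (h.add_sum_pos t fun _ => one_pos).ne h1

lemma eq_affinePoly_of_isHomogeneous_one {P : MvPolynomial σ ℝ} (hP : P.IsHomogeneous 1) :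
    P = affinePoly 0 fun n => P.coeff (Finsupp.single n 1) := by
  classical
  ext α
  by_cases hα : ∃ n, α = Finsupp.single n 1
  · obtain ⟨n, rfl⟩ := hα
    rw [coeff_affinePoly_single]
  · have hX : ∀ n : σ, ¬ Finsupp.single n 1 = α := fun n hn => hα ⟨n, hn.symm⟩
    have h1 : (affinePoly 0 fun n => P.coeff (Finsupp.single n 1)).coeff α = 0 := by
      simp [affinePoly, coeff_sum, coeff_C_mul, coeff_X, hX]
    rw [h1]
    refine hP.coeff_eq_zero fun hdeg => hα ?_
    exact (Finsupp.sum_eq_one_iff α).1 hdeg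

/-- The points with positive integer coordinates are the translates by `(1, …, 1)` of the points of
`ℕ^σ`. -/
def posPointsEquiv (σ : Type*) : (σ → ℕ) ≃ posPoints σ where
  toFun m := ⟨fun n => m n + 1, fun n => Nat.le_add_left 1 (m n)⟩
  invFun m := fun n => m.1 n - 1
  left_inv m := by
    funext n
    simp
  right_inv m := by
    ext n
    exact Nat.sub_add_cancel (m.2 n)

variable [Fintype τ]

lemma hasSum_twistedTerm {μ : σ → ℂ} (hμ : ∀ n, ‖μ n‖ = 1) {K : σ → 𝓢(ℝ, ℂ)}
    (hK : ∀ n, RepresentsGeometric (μ n) (K n)) {d : τ → ℝ} {c : τ → σ → ℝ}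
    (h : AffineAdmissible d c) {s : τ → ℂ} (hs : ∀ t, 2 * Fintype.card σ < (s t).re) :
    HasSum (fun m : posPoints σ => twistedTerm 1 (fun t => affinePoly (d t) (c t)) μ s m)
      (zetaIntegral K d c s) := by
  rw [← (posPointsEquiv σ).hasSum_iff]
  convert! hasSum_zetaIntegral hμ hK h hs using 1
  funext m
  simp only [Function.comp_apply, twistedTerm, ofReal_eval_affinePoly, Complex.cpow_neg,
    Finset.prod_inv_distrib, map_one, Complex.ofReal_one, mul_one, div_eq_mul_inv]
  rfl

lemma isZetaExtension_zetaIntegral {μ : σ → ℂ} (hμ : ∀ n, ‖μ n‖ = 1) {K : σ → 𝓢(ℝ, ℂ)}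
    (hK : ∀ n, RepresentsGeometric (μ n) (K n)) {d : τ → ℝ} {c : τ → σ → ℝ}
    (h : AffineAdmissible d c) :
    IsZetaExtension (posPoints σ) 1 (fun t => affinePoly (d t) (c t)) μ (zetaIntegral K d c) :=
  ⟨differentiable_zetaIntegral h K, 2 * Fintype.card σ, fun _ hs => hasSum_twistedTerm hμ hK h hs⟩

lemma IsZetaExtension.isZetaExtension_twistedZetaOn {E : Set (σ → ℕ)} {Q : MvPolynomial σ ℝ}
    {P : τ → MvPolynomial σ ℝ} {μ : σ → ℂ} {F : (τ → ℂ) → ℂ} (h : IsZetaExtension E Q P μ F) :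
    IsZetaExtension E Q P μ (twistedZetaOn E Q P μ) := by
  have h' : ∃ F, IsZetaExtension E Q P μ F := ⟨F, h⟩
  rw [twistedZetaOn, dif_pos h']
  exact h'.choose_spec

lemma IsZetaExtension.twistedZetaOn_eq {E : Set (σ → ℕ)} {Q : MvPolynomial σ ℝ}
    {P : τ → MvPolynomial σ ℝ} {μ : σ → ℂ} {F : (τ → ℂ) → ℂ} (h : IsZetaExtension E Q P μ F) :
    twistedZetaOn E Q P μ = F :=
  h.isZetaExtension_twistedZetaOn.unique h

/-! ### Binomial expansion at the points `-k` -/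

/-- At `s = -k` the powers are natural powers, and the binomial theorem applies under the integral
sign to the affine forms `δ t + ℓ_t`. -/
lemma zetaIntegral_neg_eq_sum [DecidableEq τ] (K : σ → 𝓢(ℝ, ℂ)) {c : τ → σ → ℝ}
    (h : AffineAdmissible 0 c) (δ : τ → ℝ) (k : τ → ℕ) :
    zetaIntegral K δ c (fun t => -(k t : ℂ)) = ∑ u ∈ Finset.Iic k,
      (∏ t, (δ t : ℂ) ^ (k t - u t)) * (∏ t, ((k t).choose (u t) : ℂ)) *
        zetaIntegral K 0 c (fun t => -(u t : ℂ)) := by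
  simp only [zetaIntegral, ← integral_const_mul]
  rw [← integral_finsetSum _ fun u _ => (integrable_zetaIntegrand h K _).const_mul _]
  congr 1
  funext y
  have hI : Finset.Iic k = Fintype.piFinset fun t => Finset.range (k t + 1) := by
    ext u
    simp [Pi.le_def]
  simp only [neg_neg, Complex.cpow_natCast]
  have hv : ∀ t, affineValue (δ t) (c t) (fun n => halfLine (y n)) =
      affineValue ((0 : τ → ℝ) t) (c t) (fun n => halfLine (y n)) + δ t := fun t => by
    simp [affineValue, add_comm]
  simp only [hv, add_pow]
  rw [Finset.prod_univ_sum, hI, Finset.mul_sum]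
  refine Finset.sum_congr rfl fun u _ => ?_
  simp only [Finset.prod_mul_distrib]
  ring

end

/-! ### Translation of the zeta series -/

section

variable {σ τ : Type*} [Fintype σ]

lemma shiftDiff_affinePoly (a : σ → ℕ) (c : σ → ℝ) :
    shiftDiff a (affinePoly 0 c) = C (∑ i, c i * a i) := by
  simp [shiftDiff, affinePoly, mul_add, Finset.sum_add_distrib]

lemma affineAdmissible_shift {c : τ → σ → ℝ} (h : AffineAdmissible 0 c) (a : σ → ℕ) :
    AffineAdmissible (fun t => ∑ i, c t i * a i) c where
  const_nonneg t := Finset.sum_nonneg fun i _ => mul_nonneg (h.coeff_nonneg t i) (Nat.cast_nonneg _)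
  coeff_nonneg := h.coeff_nonneg
  ne_zero t := Or.inr ((h.ne_zero t).resolve_left (lt_irrefl 0))
  occurs := h.occurs

lemma twistedTerm_add [Fintype τ] (a : σ → ℕ) (c : τ → σ → ℝ) (μ : σ → ℂ) (s : τ → ℂ) (m : σ → ℕ) :
    twistedTerm 1 (fun t => affinePoly 0 (c t)) μ s (a + m) =
      (∏ n, μ n ^ a n) * twistedTerm 1 (fun t => affinePoly (∑ i, c t i * a i) (c t)) μ s m := by
  have h1 : ∀ t, eval (fun n => ((a + m) n : ℝ)) (affinePoly 0 (c t)) =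
      eval (fun n => (m n : ℝ)) (affinePoly (∑ i, c t i * a i) (c t)) := fun t => by
    simp [eval_affinePoly, mul_add, Finset.sum_add_distrib]
  simp only [twistedTerm, h1, map_one, Complex.ofReal_one, mul_one]
  simp only [Pi.add_apply, pow_add, Finset.prod_mul_distrib, mul_div_assoc]

/-- The points with positive integer coordinates that do not belong to `lowPoints a` are the
translates by `a` of the points with positive integer coordinates. -/
lemma indicator_posPoints (a : σ → ℕ) (g : (σ → ℕ) → ℂ) :
    (posPoints σ).indicator g =
      (lowPoints a).indicator g + (range fun m : posPoints σ => a + m.1).indicator g := by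
  have hu : posPoints σ = lowPoints a ∪ range fun m : posPoints σ => a + m.1 := by
    ext m
    simp only [mem_union, mem_range, posPoints, lowPoints, mem_ofPred_eq]
    constructor
    · intro hm
      by_cases hlow : ∃ n, m n ≤ a n
      · exact Or.inl ⟨hm, hlow⟩
      · push Not at hlow
        refine Or.inr ⟨⟨fun n => m n - a n, fun n => Nat.sub_pos_of_lt (hlow n)⟩, ?_⟩
        funext n
        exact Nat.add_sub_cancel' (hlow n).le
    · rintro (hm | ⟨y, rfl⟩)
      · exact hm.1
      · exact fun n => (y.2 n).trans (Nat.le_add_left _ _)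
  have hd : Disjoint (lowPoints a) (range fun m : posPoints σ => a + m.1) := by
    rw [Set.disjoint_left]
    rintro _ ⟨-, n, hn⟩ ⟨y, rfl⟩
    have h1 : 1 ≤ y.1 n := y.2 n
    have h2 : a n + y.1 n ≤ a n := hn
    omega
  conv_lhs => rw [hu]
  exact indicator_union_of_disjoint hd g

/-- The zeta series splits into the part over `lowPoints a` and a translate by `a`; the
corresponding relation between entire functions holds everywhere. -/
lemma zetaIntegral_eq_add [Fintype τ] {μ : σ → ℂ} (hμ : ∀ n, ‖μ n‖ = 1) {K : σ → 𝓢(ℝ, ℂ)}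
    (hK : ∀ n, RepresentsGeometric (μ n) (K n)) {c : τ → σ → ℝ} (h : AffineAdmissible 0 c)
    (a : σ → ℕ) {F : (τ → ℂ) → ℂ}
    (hF : IsZetaExtension (lowPoints a) 1 (fun t => affinePoly 0 (c t)) μ F) (s : τ → ℂ) :
    zetaIntegral K 0 c s =
      F s + (∏ n, μ n ^ a n) * zetaIntegral K (fun t => ∑ i, c t i * a i) c s := by
  have hδ := affineAdmissible_shift h a
  obtain ⟨r, hr⟩ := hF.hasSum
  have hext : IsZetaExtension (posPoints σ) 1 (fun t => affinePoly 0 (c t)) μ fun s =>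
      F s + (∏ n, μ n ^ a n) * zetaIntegral K (fun t => ∑ i, c t i * a i) c s := by
    refine ⟨hF.differentiable.add ((differentiable_zetaIntegral hδ K).const_mul _),
      max r (2 * Fintype.card σ), fun s hs => ?_⟩
    set g : (σ → ℕ) → ℂ := twistedTerm 1 (fun t => affinePoly 0 (c t)) μ s with hg
    refine (hasSum_subtype_iff_indicator (f := g) (s := posPoints σ)).2 ?_
    rw [indicator_posPoints a]
    refine ((hasSum_subtype_iff_indicator (f := g)).1
      (hr s fun t => (le_max_left _ _).trans_lt (hs t))).add ?_
    have hinj : Function.Injective fun m : posPoints σ => a + m.1 :=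
      (add_right_injective a).comp Subtype.val_injective
    refine (hasSum_subtype_iff_indicator (f := g)
      (s := range fun m : posPoints σ => a + m.1)).1 ?_
    refine (hinj.hasSum_range_iff (f := g)).2 ?_
    simp only [Function.comp_def, hg, twistedTerm_add]
    exact (hasSum_twistedTerm hμ hK hδ fun t => (le_max_right _ _).trans_lt (hs t)).mul_left _
  exact congrFun ((isZetaExtension_zetaIntegral hμ hK h).unique hext) s

end

/-! ### Sums over the points with a small coordinate -/

section

variable {σ τ : Type*}

variable [DecidableEq σ]

/-- The point with coordinates `a i + m i` for `i ∈ I` and `b i` for `i ∉ I`. -/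
def gluePoint (a : σ → ℕ) (I : Finset σ) (b : {i // i ∉ I} → ℕ) (m : I → ℕ) : σ → ℕ :=
  fun i => if h : i ∈ I then a i + m ⟨i, h⟩ else b ⟨i, h⟩

lemma gluePoint_injective (a : σ → ℕ) (I : Finset σ) (b : {i // i ∉ I} → ℕ) :
    Function.Injective (gluePoint a I b) := fun m m' h => by
  funext i
  have := congrFun h i
  simpa [gluePoint] using this

lemma mem_range_gluePoint {a : σ → ℕ} {I : Finset σ} {b : {i // i ∉ I} → ℕ} {m : σ → ℕ} :
    (m ∈ range fun x : posPoints I => gluePoint a I b x) ↔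
      (∀ i ∈ I, a i < m i) ∧ ∀ i : {i // i ∉ I}, m i = b i := by
  constructor
  · rintro ⟨x, rfl⟩
    refine ⟨fun i hi => ?_, fun i => ?_⟩
    · have : 1 ≤ x.1 ⟨i, hi⟩ := x.2 _
      simp only [gluePoint, dif_pos hi]
      omega
    · simp only [gluePoint, dif_neg i.2]
  · rintro ⟨h1, h2⟩
    refine ⟨⟨fun i => m i - a i, fun i => Nat.sub_pos_of_lt (h1 i i.2)⟩, ?_⟩
    funext i
    by_cases hi : i ∈ I
    · simp only [gluePoint, dif_pos hi]
      exact Nat.add_sub_cancel' (h1 i hi).le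
    · simp only [gluePoint, dif_neg hi]
      exact (h2 ⟨i, hi⟩).symm

variable [Fintype σ]

/-- A point `m` of `lowPoints a` is a glued point for exactly one pair `(I, b)`: the set `I`
consists of the indices with `a i < m i`, and `b` is the restriction of `m` to its complement. -/
lemma indicator_lowPoints (a : σ → ℕ) (g : (σ → ℕ) → ℂ) :
    (lowPoints a).indicator g = ∑ I ∈ (Finset.univ : Finset (Finset σ)).erase Finset.univ,
      ∑ b ∈ lowBox a I, (range fun x : posPoints I => gluePoint a I b x).indicator g := by
  funext m
  simp only [Finset.sum_apply]
  by_cases hm : m ∈ lowPoints a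
  · set J : Finset σ := Finset.univ.filter fun i => a i < m i with hJ
    have hJmem : ∀ i, i ∈ J ↔ a i < m i := by simp [hJ]
    obtain ⟨hpos, n, hn⟩ := hm
    rw [indicator_of_mem (show m ∈ lowPoints a from ⟨hpos, n, hn⟩), Finset.sum_eq_single J]
    · rw [Finset.sum_eq_single (fun i : {i // i ∉ J} => m i)]
      · rw [indicator_of_mem]
        exact mem_range_gluePoint.2 ⟨fun i hi => (hJmem i).1 hi, fun _ => rfl⟩
      · intro b _ hb
        refine indicator_of_notMem (fun h => hb ?_) g
        funext i
        exact ((mem_range_gluePoint.1 h).2 i).symm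
      · intro h
        refine absurd ?_ h
        simp only [lowBox, Fintype.mem_piFinset, Finset.mem_Icc]
        exact fun i => ⟨hpos i, not_lt.1 fun hi => i.2 ((hJmem i).2 hi)⟩
    · intro I _ hI
      refine Finset.sum_eq_zero fun b hb => indicator_of_notMem (fun h => hI ?_) g
      obtain ⟨h1, h2⟩ := mem_range_gluePoint.1 h
      ext i
      rw [hJmem]
      refine ⟨h1 i, fun hi => by_contra fun hiI => ?_⟩
      have h3 := h2 ⟨i, hiI⟩
      have h4 := (Finset.mem_Icc.1 (Fintype.mem_piFinset.1 hb ⟨i, hiI⟩)).2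
      simp only at h3 h4
      omega
    · intro h
      refine absurd (Finset.mem_erase.2 ⟨fun hu => ?_, Finset.mem_univ J⟩) h
      have : n ∈ J := hu ▸ Finset.mem_univ n
      exact absurd ((hJmem n).1 this) (not_lt.2 hn)
  · rw [indicator_of_notMem hm]
    refine (Finset.sum_eq_zero fun I hI => Finset.sum_eq_zero fun b hb =>
      indicator_of_notMem (fun h => hm ?_) g).symm
    obtain ⟨h1, h2⟩ := mem_range_gluePoint.1 h
    have hb' : ∀ i : {i // i ∉ I}, 1 ≤ b i ∧ b i ≤ a i := fun i =>
      Finset.mem_Icc.1 (Fintype.mem_piFinset.1 hb i)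
    refine ⟨fun n => ?_, ?_⟩
    · by_cases hn : n ∈ I
      · exact (Nat.zero_le _).trans_lt (h1 n hn)
      · exact (hb' ⟨n, hn⟩).1.trans_eq (h2 ⟨n, hn⟩).symm
    · obtain ⟨n, hn⟩ : ∃ n, n ∉ I := by
        by_contra hall
        push Not at hall
        exact (Finset.mem_erase.1 hI).1 (Finset.eq_univ_iff_forall.2 hall)
      exact ⟨n, (h2 ⟨n, hn⟩).trans_le (hb' ⟨n, hn⟩).2⟩

/-! ### Partial evaluations of linear forms -/

/-- The constant term of the partial evaluation at `a`, `I`, `b` of the linear form with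
coefficients `c`. -/
def partialConst (a : σ → ℕ) (I : Finset σ) (b : {i // i ∉ I} → ℕ) (c : σ → ℝ) : ℝ :=
  ∑ i : I, c i * a i + ∑ i : {i // i ∉ I}, c i * b i

lemma sum_split (I : Finset σ) {M : Type*} [AddCommMonoid M] (f : σ → M) :
    ∑ i, f i = ∑ i : I, f i + ∑ i : {i // i ∉ I}, f i := by
  convert! (Fintype.sum_subtype_add_sum_subtype (fun i => i ∈ I) f).symm

lemma prod_split (I : Finset σ) {M : Type*} [CommMonoid M] (f : σ → M) :
    ∏ i, f i = (∏ i : I, f i) * ∏ i : {i // i ∉ I}, f i := by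
  convert! (Fintype.prod_subtype_mul_prod_subtype (fun i => i ∈ I) f).symm

lemma partialEval_affinePoly (a : σ → ℕ) (I : Finset σ) (b : {i // i ∉ I} → ℕ) (c : σ → ℝ) :
    partialEval a I b (affinePoly 0 c) = affinePoly (partialConst a I b c) fun i : I => c i := by
  simp only [partialEval, affinePoly, map_add, map_sum, map_mul, bind₁_C_right, bind₁_X_right,
    C_0, zero_add, partialConst]
  rw [sum_split I]
  have h1 : ∀ i : I, (if h : (i : σ) ∈ I then C (a i : ℝ) + X (R := ℝ) (⟨i, h⟩ : I)
      else C (b ⟨i, h⟩ : ℝ)) = C (a i : ℝ) + X i := fun i => dif_pos i.2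
  have h2 : ∀ i : {i // i ∉ I}, (if h : (i : σ) ∈ I then C (a i : ℝ) + X (R := ℝ) (⟨i, h⟩ : I)
      else C (b ⟨i, h⟩ : ℝ)) = C (b i : ℝ) := fun i => dif_neg i.2
  simp only [h1, h2, mul_add, Finset.sum_add_distrib]
  ring

lemma affineAdmissible_partialConst {c : τ → σ → ℝ} (h : AffineAdmissible 0 c) (a : σ → ℕ)
    (I : Finset σ) {b : {i // i ∉ I} → ℕ} (hb : b ∈ lowBox a I) :
    AffineAdmissible (fun t => partialConst a I b (c t)) fun t (i : I) => c t i where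
  const_nonneg t := add_nonneg
    (Finset.sum_nonneg fun i _ => mul_nonneg (h.coeff_nonneg t i) (Nat.cast_nonneg _))
    (Finset.sum_nonneg fun i _ => mul_nonneg (h.coeff_nonneg t i) (Nat.cast_nonneg _))
  coeff_nonneg t i := h.coeff_nonneg t i
  ne_zero t := by
    obtain ⟨n, hn⟩ := (h.ne_zero t).resolve_left (lt_irrefl 0)
    by_cases hI : n ∈ I
    · exact Or.inr ⟨⟨n, hI⟩, hn⟩
    · refine Or.inl (add_pos_of_nonneg_of_pos
        (Finset.sum_nonneg fun i _ => mul_nonneg (h.coeff_nonneg t i) (Nat.cast_nonneg _))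
        (Finset.sum_pos' (fun i _ => mul_nonneg (h.coeff_nonneg t i) (Nat.cast_nonneg _))
          ⟨⟨n, hI⟩, Finset.mem_univ _, mul_pos hn (Nat.cast_pos.2 ?_)⟩))
      exact (Finset.mem_Icc.1 (Fintype.mem_piFinset.1 hb ⟨n, hI⟩)).1
  occurs i := h.occurs i

variable [Fintype τ]

lemma twistedTerm_gluePoint (a : σ → ℕ) (I : Finset σ) (b : {i // i ∉ I} → ℕ) (c : τ → σ → ℝ)
    (μ : σ → ℂ) (s : τ → ℂ) (m : I → ℕ) :
    twistedTerm 1 (fun t => affinePoly 0 (c t)) μ s (gluePoint a I b m) =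
      (∏ i : {i // i ∉ I}, μ i ^ b i) * (∏ i : I, μ i ^ a i) *
        twistedTerm 1 (fun t => affinePoly (partialConst a I b (c t)) fun i : I => c t i)
          (fun i : I => μ i) s m := by
  have g1 : ∀ i : I, gluePoint a I b m i = a i + m i := fun i => dif_pos i.2
  have g2 : ∀ i : {i // i ∉ I}, gluePoint a I b m i = b i := fun i => dif_neg i.2
  have h1 : ∀ t, eval (fun n => (gluePoint a I b m n : ℝ)) (affinePoly 0 (c t)) =
      eval (fun n => (m n : ℝ)) (affinePoly (partialConst a I b (c t)) fun i : I => c t i) :=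
    fun t => by
      rw [eval_affinePoly, eval_affinePoly, sum_split I]
      simp only [g1, g2, partialConst, Nat.cast_add, mul_add, Finset.sum_add_distrib]
      ring
  simp only [twistedTerm, h1, map_one, Complex.ofReal_one, mul_one]
  rw [prod_split I]
  simp only [g1, g2, pow_add, Finset.prod_mul_distrib]
  ring

/-- The zeta series over `lowPoints a` extends to the corresponding linear combination of the
integrals `zetaIntegral` in fewer variables. -/
lemma isZetaExtension_lowPoints {μ : σ → ℂ} (hμ : ∀ n, ‖μ n‖ = 1) {K : σ → 𝓢(ℝ, ℂ)}
    (hK : ∀ n, RepresentsGeometric (μ n) (K n)) {c : τ → σ → ℝ} (h : AffineAdmissible 0 c)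
    (a : σ → ℕ) :
    IsZetaExtension (lowPoints a) 1 (fun t => affinePoly 0 (c t)) μ fun s =>
      ∑ I ∈ (Finset.univ : Finset (Finset σ)).erase Finset.univ, ∑ b ∈ lowBox a I,
        (∏ i : {i // i ∉ I}, μ i ^ b i) * (∏ i : I, μ i ^ a i) *
          zetaIntegral (fun i : I => K i) (fun t => partialConst a I b (c t))
            (fun t (i : I) => c t i) s := by
  refine ⟨?_, 2 * Fintype.card σ, fun s hs => ?_⟩
  · refine Differentiable.fun_sum fun I _ => Differentiable.fun_sum fun b hb => ?_
    exact (differentiable_zetaIntegral (affineAdmissible_partialConst h a I hb) _).const_mul _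
  · set g : (σ → ℕ) → ℂ := twistedTerm 1 (fun t => affinePoly 0 (c t)) μ s with hg
    refine (hasSum_subtype_iff_indicator (f := g) (s := lowPoints a)).2 ?_
    rw [indicator_lowPoints]
    simp only [Finset.sum_fn]
    refine hasSum_sum fun I _ => hasSum_sum fun b hb => ?_
    have hinj : Function.Injective fun x : posPoints I => gluePoint a I b x :=
      (gluePoint_injective a I b).comp Subtype.val_injective
    refine (hasSum_subtype_iff_indicator (f := g)
      (s := range fun x : posPoints I => gluePoint a I b x)).1 ?_
    refine (hinj.hasSum_range_iff (f := g)).2 ?_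
    simp only [Function.comp_def, hg, twistedTerm_gluePoint]
    refine (hasSum_twistedTerm (μ := fun i : I => μ i) (fun i => hμ i) (fun i => hK i)
      (affineAdmissible_partialConst h a I hb) fun t => lt_of_le_of_lt ?_ (hs t)).mul_left _
    have : Fintype.card I ≤ Fintype.card σ := Fintype.card_subtype_le _
    gcongr

end

end

theorem corollary1 {N T : ℕ} (μ : Fin N → ℂ) (hμ : ∀ n, ‖μ n‖ = 1 ∧ μ n ≠ 1)
    (L : Fin T → MvPolynomial (Fin N) ℝ)
    (hlin : ∀ t, (L t).IsHomogeneous 1) (hne : ∀ t, L t ≠ 0)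
    (hcoeff : ∀ t α, 0 ≤ (L t).coeff α)
    (hdep : ∀ n, ∃ t, n ∈ (L t).vars)
    (a : Fin N → ℕ) :
    -- the zeta series of the forms `L t` extends to an entire function `Z(μ; ·)`
    IsZetaExtension (posPoints (Fin N)) 1 L μ (twistedZeta 1 L μ) ∧
    -- so does the sum over `E(a)`, which gives `Z^a_{N-1}`
    IsZetaExtension (lowPoints a) 1 L μ (twistedZetaOn (lowPoints a) 1 L μ) ∧
    -- `Z^a_{N-1}` is a finite linear combination of zeta functions, in at most `N - 1` variables,
    -- of polynomials of degree at most one that satisfy the same positivity conditions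
    (∀ I : Finset (Fin N), I ≠ Finset.univ → ∀ b ∈ lowBox a I,
      (∀ t, (partialEval a I b (L t)).totalDegree ≤ 1 ∧ partialEval a I b (L t) ≠ 0 ∧
        ∀ α, 0 ≤ (partialEval a I b (L t)).coeff α) ∧
      (∀ i : I, ∃ t, i ∈ (partialEval a I b (L t)).vars) ∧
      IsZetaExtension (posPoints I) 1 (fun t => partialEval a I b (L t)) (fun i : I => μ i)
        (twistedZeta 1 (fun t => partialEval a I b (L t)) (fun i : I => μ i))) ∧
    (∀ s : Fin T → ℂ, twistedZetaOn (lowPoints a) 1 L μ s =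
      ∑ I ∈ (Finset.univ : Finset (Fin N)).ssubsets, ∑ b ∈ lowBox a I,
        (∏ i : {i // i ∉ I}, μ i ^ b i) * (∏ i : I, μ i ^ a i) *
          twistedZeta 1 (fun t => partialEval a I b (L t)) (fun i : I => μ i) s) ∧
    -- the differences `δ t` are real numbers, and the values satisfy the recurrence relation
    ∃ δ : Fin T → ℝ, (∀ t, shiftDiff a (L t) = MvPolynomial.C (δ t)) ∧
      ∀ k : Fin T → ℕ,
        (1 - ∏ n, μ n ^ a n) * twistedZeta 1 L μ (fun t => -(k t : ℂ)) =
          (∏ n, μ n ^ a n) * ∑ u ∈ Finset.Iio k,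
            (∏ t, (δ t : ℂ) ^ (k t - u t)) * (∏ t, ((k t).choose (u t) : ℂ)) *
              twistedZeta 1 L μ (fun t => -(u t : ℂ)) +
          twistedZetaOn (lowPoints a) 1 L μ (fun t => -(k t : ℂ)) := by
  have hμ1 : ∀ n, ‖μ n‖ = 1 := fun n => (hμ n).1
  choose K hK using fun n => exists_schwartzMap_hasSum (hμ n).1 (hμ n).2
  obtain ⟨c, rfl⟩ : ∃ c : Fin T → Fin N → ℝ, L = fun t => affinePoly 0 (c t) :=
    ⟨_, funext fun t => eq_affinePoly_of_isHomogeneous_one (hlin t)⟩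
  have hc0 : ∀ t n, 0 ≤ c t n := fun t n => by
    have := hcoeff t (Finsupp.single n 1)
    rwa [coeff_affinePoly_single] at this
  have hadm : AffineAdmissible 0 c := by
    refine ⟨fun _ => le_rfl, hc0, fun t => Or.inr ?_, fun n => ?_⟩
    · by_contra hall
      push Not at hall
      refine hne t ?_
      simp [affinePoly, fun n => le_antisymm (hall n) (hc0 t n)]
    · obtain ⟨t, ht⟩ := hdep n
      exact ⟨t, lt_of_le_of_ne (hc0 t n) (mem_vars_affinePoly.1 ht).symm⟩
  have hZ : IsZetaExtension (posPoints (Fin N)) 1 (fun t => affinePoly 0 (c t)) μ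
      (zetaIntegral K 0 c) := isZetaExtension_zetaIntegral hμ1 hK hadm
  have hlow := isZetaExtension_lowPoints hμ1 hK hadm a
  have hpart : ∀ I : Finset (Fin N), ∀ b ∈ lowBox a I, _ := fun I b hb =>
    isZetaExtension_zetaIntegral (μ := fun i : I => μ i) (fun i => hμ1 i) (fun i : I => hK i)
      (affineAdmissible_partialConst hadm a I hb)
  refine ⟨hZ.isZetaExtension_twistedZetaOn, hlow.isZetaExtension_twistedZetaOn, ?_, ?_, ?_⟩
  · intro I _ b hb
    simp only [partialEval_affinePoly]
    have hadm' := affineAdmissible_partialConst hadm a I hb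
    refine ⟨fun t => ⟨totalDegree_affinePoly_le _ _, affinePoly_ne_zero hadm' t,
      coeff_affinePoly_nonneg (hadm'.const_nonneg t) (hadm'.coeff_nonneg t)⟩, fun i => ?_,
      (hpart I b hb).isZetaExtension_twistedZetaOn⟩
    obtain ⟨t, ht⟩ := hadm'.occurs i
    exact ⟨t, mem_vars_affinePoly.2 ht.ne'⟩
  · intro s
    rw [hlow.twistedZetaOn_eq]
    refine Finset.sum_congr (by ext I; simp [Finset.ssubset_univ_iff]) fun I _ =>
      Finset.sum_congr rfl fun b hb => ?_
    simp only [partialEval_affinePoly]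
    rw [twistedZeta, (hpart I b hb).twistedZetaOn_eq]
  · refine ⟨fun t => ∑ i, c t i * a i, fun t => shiftDiff_affinePoly a (c t), fun k => ?_⟩
    -- The term `u = k` of the binomial expansion is the value of the zeta function itself.
    have h1 := zetaIntegral_eq_add hμ1 hK hadm a hlow.isZetaExtension_twistedZetaOn
      fun t => -(k t : ℂ)
    rw [zetaIntegral_neg_eq_sum K hadm (fun t => ∑ i, c t i * a i), ← Finset.Iio_insert,
      Finset.sum_insert (by simp)] at h1
    simp only [twistedZeta, hZ.twistedZetaOn_eq]
    simp only [Nat.sub_self, pow_zero, Finset.prod_const_one, Nat.choose_self, Nat.cast_one,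
      one_mul] at h1
    linear_combination h1
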